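/- Conventions. All functions are complex valued. For $f\in L_2(\mathbb R^2)$ let $\operatorname{Op}(f)$ be the integral operator on $L_2(\mathbb R)$ given by $\operatorname{Op}(f)g(y)=\int_{\mathbb R} f(x,y)g(x)\,dx$. For a bounded operator $T$ on a Hilbert space and $0<p<\infty$ let $\mu(n,T)=\inf\{\|T-R\| : \operatorname{rank} R\le n\}$ and $\|T\|_p=\big(\sum_{n\ge 0}\mu(n,T)^p\big)^{1/p}\in[0,\infty]$. For $k\in L_\infty(\mathbb R^2)$ put $$\|k\|_{\mathfrak M_p}=\sup\{\|\operatorname{Op}(kf)\|_p : f\in L_2(\mathbb R^2),\ \|\operatorname{Op}(f)\|_p\le 1\}\in[0,\infty].$$ For $0<p<2$ let $p^\flat=\frac{2p}{2-p}$. A function $\varphi$ on $\mathbb R$ is an orthonormal wavelet if the functions $\varphi_{j,l}(t)=2^{j/2}\varphi(2^jt-l)$, $j,l\in\mathbb Z$, form an orthonormal basis of $L_2(\mathbb R)$. Statement. Let $\varphi$ be a compactly supported, essentially bounded orthonormal wavelet (for example, any compactly supported $C^N$ wavelet, $N\ge 0$). There is a finite constant $C$, depending only on $\varphi$, such that the following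 holds for every $0<p<2$, every $k\in L_\infty(\mathbb R^2)$ and every $j\in\mathbb Z$. Put $$k_{j,l}(s)=\int_{\mathbb R}\varphi_{j,l}(t)\,k(t,s)\,dt\quad(l\in\mathbb Z),\qquad k_j(t,s)=\sum_{l\in\mathbb Z}\varphi_{j,l}(t)\,k_{j,l}(s).$$ Then $k_j\in L_\infty(\mathbb R^2)$ and $$\|k_j\|_{\mathfrak M_p}\le C\,2^{j/2}\,\Big(\sum_{l\in\mathbb Z}\|k_{j,l}\|_\infty^{p^\flat}\Big)^{1/p^\flat},$$ where the right-hand side may be $+\infty$. In particular this holds for every bounded $k\in\dot B^{1/p^\flat}_{p^\flat,p}(\mathbb R,L_\infty(\mathbb R))$. -/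

import Mathlib

open MeasureTheory
open scoped ENNReal NNReal

noncomputable section

/-! ### Integral operators with square-integrable kernel -/

/-- Almost every slice `x ↦ f (x, y)` of a square-integrable function of two variables is
square-integrable. -/
lemma SchurWavelet.memLp_slice {f : ℝ × ℝ → ℂ} (hf : MemLp f 2 volume) :
    ∀ᵐ y : ℝ, MemLp (fun x : ℝ => f (x, y)) 2 volume := by
  have hs : MemLp (fun z : ℝ × ℝ => f z.swap) 2 (volume.prod volume) :=
    hf.comp_measurePreserving (Measure.measurePreserving_swap (μ := volume) (ν := volume))
  have h1 := hs.1.prodMk_left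
  have h2 : ∫⁻ z : ℝ × ℝ, ‖f z.swap‖ₑ ^ (2 : ℝ) ∂(volume.prod volume) < ∞ := by
    simpa using lintegral_rpow_enorm_lt_top_of_eLpNorm_lt_top two_ne_zero ENNReal.ofNat_ne_top hs.2
  have hm : AEMeasurable (fun z : ℝ × ℝ => ‖f z.swap‖ₑ ^ (2 : ℝ)) (volume.prod volume) :=
    hs.1.enorm.pow_const _
  rw [lintegral_prod _ hm] at h2
  have h3 := ae_lt_top' hm.lintegral_prod_right' h2.ne
  filter_upwards [h1, h3] with y hy1 hy3
  refine ⟨hy1, ?_⟩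
  rw [eLpNorm_lt_top_iff_lintegral_rpow_enorm_lt_top two_ne_zero ENNReal.ofNat_ne_top]
  simpa using hy3

/-- The Cauchy--Schwarz bound for integral operators, together with measurability of the image. -/
lemma SchurWavelet.memLp_integral {f : ℝ × ℝ → ℂ} (hf : MemLp f 2 volume) {g : ℝ → ℂ}
    (hg : MemLp g 2 volume) :
    MemLp (fun y : ℝ => ∫ x : ℝ, f (x, y) * g x) 2 volume ∧
      eLpNorm (fun y : ℝ => ∫ x : ℝ, f (x, y) * g x) 2 volume
        ≤ eLpNorm f 2 volume * eLpNorm g 2 volume := by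
  have hmp : MeasurePreserving (Prod.swap : ℝ × ℝ → ℝ × ℝ) (volume.prod volume)
      (volume.prod volume) := Measure.measurePreserving_swap
  have hs : MemLp (fun z : ℝ × ℝ => f z.swap) 2 (volume.prod volume) :=
    hf.comp_measurePreserving hmp
  have hnorm : eLpNorm (fun z : ℝ × ℝ => f z.swap) 2 (volume.prod volume) = eLpNorm f 2 volume :=
    eLpNorm_comp_measurePreserving hf.1 hmp
  have hmeas : AEStronglyMeasurable (fun y : ℝ => ∫ x : ℝ, f (x, y) * g x) volume := by
    have : AEStronglyMeasurable (fun z : ℝ × ℝ => f z.swap * g z.2) (volume.prod volume) :=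
      hs.1.mul hg.1.comp_snd
    exact this.integral_prod_right'
  have hm : AEMeasurable (fun z : ℝ × ℝ => ‖f z.swap‖ₑ ^ (2 : ℝ)) (volume.prod volume) :=
    hs.1.enorm.pow_const _
  have hbound : eLpNorm (fun y : ℝ => ∫ x : ℝ, f (x, y) * g x) 2 volume
      ≤ eLpNorm f 2 volume * eLpNorm g 2 volume := by
    rw [← hnorm]
    simp only [eLpNorm_eq_lintegral_rpow_enorm_toReal two_ne_zero ENNReal.ofNat_ne_top,
      ENNReal.toReal_ofNat]
    rw [← ENNReal.mul_rpow_of_nonneg _ _ (by norm_num : (0 : ℝ) ≤ 1 / 2)]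
    refine ENNReal.rpow_le_rpow ?_ (by norm_num)
    rw [lintegral_prod _ hm, ← lintegral_mul_const'' _ hm.lintegral_prod_right']
    refine lintegral_mono_ae ?_
    filter_upwards [SchurWavelet.memLp_slice hf] with y hy
    have h1 : ‖∫ x : ℝ, f (x, y) * g x‖ₑ ≤ ∫⁻ x : ℝ, ‖f (x, y)‖ₑ * ‖g x‖ₑ := by
      refine (enorm_integral_le_lintegral_enorm _).trans (le_of_eq ?_)
      simp only [enorm_mul]
    have h2 : ∫⁻ x : ℝ, ‖f (x, y)‖ₑ * ‖g x‖ₑ ≤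
        (∫⁻ x : ℝ, ‖f (x, y)‖ₑ ^ (2 : ℝ)) ^ (1 / 2 : ℝ) *
          (∫⁻ x : ℝ, ‖g x‖ₑ ^ (2 : ℝ)) ^ (1 / 2 : ℝ) :=
      ENNReal.lintegral_mul_le_Lp_mul_Lq volume (Real.holderConjugate_iff.2 (by norm_num))
        hy.1.enorm hg.1.enorm
    calc ‖∫ x : ℝ, f (x, y) * g x‖ₑ ^ (2 : ℝ)
        ≤ ((∫⁻ x : ℝ, ‖f (x, y)‖ₑ ^ (2 : ℝ)) ^ (1 / 2 : ℝ) *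
          (∫⁻ x : ℝ, ‖g x‖ₑ ^ (2 : ℝ)) ^ (1 / 2 : ℝ)) ^ (2 : ℝ) :=
          ENNReal.rpow_le_rpow (h1.trans h2) (by norm_num)
      _ = _ := by
          rw [← ENNReal.mul_rpow_of_nonneg _ _ (by norm_num : (0 : ℝ) ≤ 1 / 2),
            ← ENNReal.rpow_mul]
          norm_num
  exact ⟨⟨hmeas, hbound.trans_lt (ENNReal.mul_lt_top hf.2 hg.2)⟩, hbound⟩

/-- The integral operator `Op(f)` on `L₂(ℝ)` with kernel `f ∈ L₂(ℝ²)`,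
`Op(f) g (y) = ∫ f(x, y) g(x) dx`. -/
def SchurWavelet.integralOp (f : ℝ × ℝ → ℂ) (hf : MemLp f 2 volume) :
    Lp ℂ 2 (volume : Measure ℝ) →L[ℂ] Lp ℂ 2 (volume : Measure ℝ) :=
  LinearMap.mkContinuous
    { toFun := fun g =>
        (SchurWavelet.memLp_integral hf (Lp.memLp g)).1.toLp
          (fun y : ℝ => ∫ x : ℝ, f (x, y) * g x)
      map_add' := by
        intro g h
        rw [← MemLp.toLp_add, MemLp.toLp_eq_toLp_iff]
        filter_upwards [SchurWavelet.memLp_slice hf] with y hy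
        have hg : Integrable (fun x => f (x, y) * g x) volume := hy.integrable_mul (Lp.memLp g)
        have hh : Integrable (fun x => f (x, y) * h x) volume := hy.integrable_mul (Lp.memLp h)
        rw [Pi.add_apply, ← integral_add hg hh]
        refine integral_congr_ae ?_
        filter_upwards [Lp.coeFn_add g h] with x hx
        rw [hx]
        simp [mul_add]
      map_smul' := by
        intro c g
        rw [RingHom.id_apply, ← MemLp.toLp_const_smul, MemLp.toLp_eq_toLp_iff]
        refine Filter.Eventually.of_forall fun y => ?_
        rw [Pi.smul_apply, ← integral_smul]
        refine integral_congr_ae ?_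
        filter_upwards [Lp.coeFn_smul c g] with x hx
        rw [hx]
        simp only [Pi.smul_apply, smul_eq_mul]
        ring }
    (eLpNorm f 2 volume).toReal
    (by
      intro g
      simp only [LinearMap.coe_mk, AddHom.coe_mk, Lp.norm_def]
      rw [← ENNReal.toReal_mul, eLpNorm_congr_ae (MemLp.coeFn_toLp _)]
      exact ENNReal.toReal_mono (ENNReal.mul_ne_top hf.2.ne (Lp.memLp g).2.ne)
        (SchurWavelet.memLp_integral hf (Lp.memLp g)).2)

/-! ### Singular values and Schatten--von Neumann quasi-norms -/

/-- The `n`-th singular value `μ(n, T) = inf {‖T - R‖ : rank R ≤ n}`. -/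
def SchurWavelet.singularValue {H : Type*} [NormedAddCommGroup H] [InnerProductSpace ℂ H]
    (n : ℕ) (T : H →L[ℂ] H) : ℝ≥0∞ :=
  ⨅ (R : H →L[ℂ] H) (_ : (R : H →ₗ[ℂ] H).rank ≤ n), ‖T - R‖ₑ

/-- The quasi-norm `‖T‖_p = (∑ₙ μ(n, T)^p)^{1/p}` for `0 < p < ∞`; it is `∞` exactly when `T` is
not in the Schatten--von Neumann class. -/
def SchurWavelet.schattenNorm {H : Type*} [NormedAddCommGroup H] [InnerProductSpace ℂ H]
    (p : ℝ) (T : H →L[ℂ] H) : ℝ≥0∞ :=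
  (∑' n : ℕ, SchurWavelet.singularValue n T ^ p) ^ (1 / p)

/-! ### Schur multipliers -/

/-- The quasi-norm `‖k‖_{𝔐_p} = sup {‖Op(k f)‖_p : f ∈ L₂(ℝ²), ‖Op(f)‖_p ≤ 1}` of
`k ∈ L_∞(ℝ²)`; it is `∞` exactly when `k` is not an `𝓛_p`-Schur multiplier. -/
def SchurWavelet.multiplierNorm (p : ℝ) (k : ℝ × ℝ → ℂ) (hk : MemLp k ∞ volume) : ℝ≥0∞ :=
  ⨆ (f : ℝ × ℝ → ℂ) (hf : MemLp f 2 volume)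
    (_ : SchurWavelet.schattenNorm p (SchurWavelet.integralOp f hf) ≤ 1),
    SchurWavelet.schattenNorm p
      (SchurWavelet.integralOp (fun z => k z * f z) (hf.mul' hk))

/-! ### Wavelets -/

/-- `φ_{j,l}(t) = 2^{j/2} φ(2^j t - l)`. -/
def SchurWavelet.waveletFun (φ : ℝ → ℂ) (j l : ℤ) (t : ℝ) : ℂ :=
  (((2 : ℝ) ^ ((j : ℝ) / 2) : ℝ) : ℂ) * φ ((2 : ℝ) ^ j * t - l)

/-- `φ` is an orthonormal wavelet, that is, the wavelet system `(φ_{j,l})_{j,l ∈ ℤ}` is an orthonormal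
(Hilbert) basis of `L₂(ℝ)`. -/
def SchurWavelet.IsOrthonormalWavelet (φ : ℝ → ℂ) : Prop :=
  ∃ b : HilbertBasis (ℤ × ℤ) ℂ (Lp ℂ 2 (volume : Measure ℝ)),
    ∀ j l : ℤ, (b (j, l) : ℝ → ℂ) =ᵐ[volume] SchurWavelet.waveletFun φ j l

/-- The wavelet coefficient function `k_{j,l}(s) = ∫ φ_{j,l}(t) k(t, s) dt`. -/
def SchurWavelet.waveletCoeff (φ : ℝ → ℂ) (k : ℝ × ℝ → ℂ) (j l : ℤ) (s : ℝ) : ℂ :=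
  ∫ t : ℝ, SchurWavelet.waveletFun φ j l t * k (t, s)

/-- The scale-`j` part `k_j(t, s) = ∑_l φ_{j,l}(t) k_{j,l}(s)`. (For compactly supported `φ` the
sum has only finitely many nonzero terms at each point.) -/
def SchurWavelet.scalePart (φ : ℝ → ℂ) (k : ℝ × ℝ → ℂ) (j : ℤ) (z : ℝ × ℝ) : ℂ :=
  ∑' l : ℤ, SchurWavelet.waveletFun φ j l z.1 * SchurWavelet.waveletCoeff φ k j l z.2

/-- The exponent `p^♭ = 2p / (2 - p)`, for `0 < p < 2`. -/
def SchurWavelet.flat (p : ℝ) : ℝ := 2 * p / (2 - p)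

/-- The `ℓ_q(ℤ)` quasi-norm of a sequence of nonnegative extended reals, `0 < q < ∞`. -/
def SchurWavelet.ellNorm (q : ℝ) (a : ℤ → ℝ≥0∞) : ℝ≥0∞ :=
  (∑' l : ℤ, a l ^ q) ^ (1 / q)

end

/-! Put `a_l = φ_{j,l}` and `b_l = k_{j,l}`. Since `φ` is bounded with compact support, the `a_l`
are bounded by `β = 2^{j/2} ‖φ‖_∞`, and at most `N = 2R + 1` of their support intervals `U_l`
contain a given point. With `A = Op(f)`, the operator `Op(k_j f)` is the limit of the finite sums `T
= ∑ M_l A S_l Φ_l`, where `Φ_l`, `S_l`, `M_l` are multiplication by `a_l`, by the indicator of `U_l`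
and by `b_l`. The redundant `S_l` keeps the localization of `A` once `Φ_l` has been removed.

Write `X_l = M_l A S_l`. Bounded overlap gives `‖T^* y‖² ≤ N β² ∑ ‖X_l^* y‖²`, so the singular
values of `T` are controlled by the eigenvalues `c_i` of `∑ X_l X_l^*`. This operator equals `∑ h ⊗
h` over the vectors `h = X_l w_{l,i}`, for any choice of orthonormal bases `w_l`, and concavity of
`x^{p/2}` gives `∑ c_i^{p/2} ≤ ∑ ‖X_l w_{l,i}‖^p` (`tsum_eigenvalue_rpow_le`). The factor `M_l`
costs at most `‖b_l‖_∞^p`.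

Let `w_l` diagonalize `(A S_l)^* (A S_l)` and let `e` diagonalize `A A^*`. The same concavity lemma
bounds `∑_i ‖A S_l w_{l,i}‖^p` by `∑_i ‖S_l^* A^* e_i‖^p`. For fixed `i`, Hölder in `l` with weights
`1 - p/2` and `p/2` separates `(∑ ‖b_l‖_∞^{p^♭})^{1-p/2}`, as `p^♭ (1 - p/2) = p`, from `(∑_l ‖S_l^*
A^* e_i‖²)^{p/2} ≤ N^{p/2} ‖A^* e_i‖^p`. Finally `∑ ‖A^* e_i‖^p ≤ ‖A‖_p^p`. Taking `p`-th roots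
gives the constant `N β`, free of `p`. -/

open scoped InnerProductSpace

open ContinuousLinearMap (adjoint)

/-! ### Diagonalization and comparison of power sums -/

open scoped ComplexOrder in
theorem SchurWavelet.exists_hilbertBasis_eigenvectors.{u} {H : Type u} [NormedAddCommGroup H]
    [InnerProductSpace ℂ H] [CompleteSpace H] {K : H →L[ℂ] H} (hK : K.IsPositive)
    (hc : IsCompactOperator K) :
    ∃ (ι : Type u) (w : HilbertBasis ι ℂ H) (c : ι → ℝ),
      (∀ i, 0 ≤ c i) ∧ ∀ i, K (w i) = (c i : ℂ) • w i := by
  have hsym : (K : H →ₗ[ℂ] H).IsSymmetric := hK.isSymmetric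
  let V : ℂ → Submodule ℂ H := fun μ => Module.End.eigenspace (K : H →ₗ[ℂ] H) μ
  have hVK : ∀ μ (x : V μ), K x = μ • (x : H) := fun μ x => Module.End.mem_eigenspace_iff.1 x.2
  have hV : ∀ μ, CompleteSpace (V μ) := by
    intro μ
    have : (V μ : Set H) = {x | K x = μ • x} := by
      ext x; exact Module.End.mem_eigenspace_iff
    have hcl : IsClosed (V μ : Set H) := by
      rw [this]
      exact isClosed_eq K.continuous (continuous_const_smul μ)
    exact hcl.completeSpace_coe
  have hb : ∀ μ, ∃ (s : Set (V μ)) (b : HilbertBasis s ℂ (V μ)), ⇑b = ((↑) : s → V μ) :=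
    fun μ => exists_hilbertBasis ℂ (V μ)
  choose s b _ using hb
  let v : (Σ μ, s μ) → H := fun a => ((b a.1 a.2 : V a.1) : H)
  have hon : Orthonormal ℂ v :=
    hsym.orthogonalFamily_eigenspaces.orthonormal_sigma_orthonormal
      (v_family := fun μ i => b μ i) fun μ => (b μ).orthonormal
  have hbot : (Submodule.span ℂ (Set.range v))ᗮ = ⊥ := by
    rw [eq_bot_iff, ← ContinuousLinearMap.orthogonalComplement_iSup_eigenspaces_eq_bot hc hsym]
    intro x hx
    rw [← Submodule.iInf_orthogonal, Submodule.mem_iInf]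
    intro μ
    have h0 : (V μ).orthogonalProjectionOnto x = 0 := by
      apply (b μ).repr.injective
      ext i
      rw [map_zero, HilbertBasis.repr_apply_apply]
      have := (Submodule.mem_orthogonal _ _).1 hx _ (Submodule.subset_span ⟨⟨μ, i⟩, rfl⟩)
      simpa [v] using this
    exact (Submodule.orthogonalProjectionOnto_eq_zero_iff).1 h0
  have hev : ∀ a, K (v a) = a.1 • v a := fun a => hVK a.1 (b a.1 a.2)
  have hnn : ∀ a : Σ μ, s μ, 0 ≤ a.1 := by
    intro a
    have h2 := hK.inner_nonneg_right (v a)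
    rwa [hev, inner_smul_right, inner_self_eq_norm_sq_to_K, hon.1 a, RCLike.ofReal_one, one_pow,
      mul_one] at h2
  refine ⟨Σ μ, s μ, HilbertBasis.mkOfOrthogonalEqBot hon hbot, fun a => a.1.re,
    fun a => (Complex.le_def.1 (hnn a)).1, fun a => ?_⟩
  have h3 : ((a.1.re : ℝ) : ℂ) = a.1 := (Complex.eq_re_of_ofReal_le (r := 0) (by simpa using hnn a)).symm
  rw [HilbertBasis.coe_mkOfOrthogonalEqBot, h3]
  exact hev a

/-- Induction on finite sets: the least value of `a` on a set of `n + 1` indices is at most `b n`,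
and that index can be removed. -/
theorem SchurWavelet.tsum_le_tsum_of_card_le {ι : Type*} {a : ι → ℝ≥0∞} {b : ℕ → ℝ≥0∞}
    (h : ∀ (F : Finset ι) (n : ℕ), F.card = n + 1 → ∀ t, (∀ i ∈ F, t ≤ a i) → t ≤ b n) :
    ∑' i, a i ≤ ∑' n, b n := by
  classical
  have key : ∀ (n : ℕ) (F : Finset ι), F.card = n → ∑ i ∈ F, a i ≤ ∑ m ∈ Finset.range n, b m := by
    intro n
    induction n with
    | zero => intro F hF; simp [Finset.card_eq_zero.1 hF]
    | succ n ih =>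
      intro F hF
      obtain ⟨i, hi, hmin⟩ := F.exists_min_image a (Finset.card_pos.1 (by omega))
      rw [← Finset.sum_erase_add _ _ hi, Finset.sum_range_succ]
      exact add_le_add (ih _ (by rw [Finset.card_erase_of_mem hi]; omega)) (h F n hF _ hmin)
  rw [ENNReal.tsum_eq_iSup_sum]
  exact iSup_le fun F => (key _ F rfl).trans (ENNReal.sum_le_tsum _)

/-- Greedy selection of distinct indices. Only values strictly below `b n` can be reached, so each
choice loses a factor `θ < 1`, which tends to `1` at the end. -/
theorem SchurWavelet.tsum_le_tsum_of_exists_notMem {ι : Type*} {a : ι → ℝ≥0∞} {b : ℕ → ℝ≥0∞}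
    (h : ∀ (F : Finset ι) (n : ℕ), F.card ≤ n → ∀ t < b n, ∃ i ∉ F, t ≤ a i) (hb : ∀ n, b n ≠ ∞) :
    ∑' n, b n ≤ ∑' i, a i := by
  classical
  have key : ∀ θ : ℝ≥0∞, θ < 1 → ∀ n : ℕ, ∃ F : Finset ι, F.card ≤ n ∧
      θ * ∑ m ∈ Finset.range n, b m ≤ ∑ i ∈ F, a i := by
    intro θ hθ n
    induction n with
    | zero => exact ⟨∅, by simp⟩
    | succ n ih =>
      obtain ⟨F, hF, hle⟩ := ih
      rw [Finset.sum_range_succ, mul_add]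
      -- When `b n = 0` nothing lies strictly below it, so no index is added.
      rcases eq_or_ne (b n) 0 with h0 | h0
      · exact ⟨F, hF.trans n.le_succ, by simpa [h0] using hle⟩
      · have hlt : θ * b n < b n := by
          simpa using ENNReal.mul_lt_mul_left h0 (hb n) hθ
        obtain ⟨i, hi, hle'⟩ := h F n hF _ hlt
        refine ⟨insert i F, (Finset.card_insert_le _ _).trans (by omega), ?_⟩
        rw [Finset.sum_insert hi, add_comm]
        exact add_le_add hle' hle
  rw [ENNReal.tsum_eq_iSup_nat]
  refine iSup_le fun n => ENNReal.le_of_forall_nnreal_lt fun r hr => ?_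
  have h2 : ∀ θ : ℝ≥0∞, θ < 1 → θ * ∑ m ∈ Finset.range n, b m ≤ ∑' i, a i := fun θ hθ => by
    obtain ⟨F, -, hF⟩ := key θ hθ n
    exact hF.trans (ENNReal.sum_le_tsum _)
  have hpos : (∑ m ∈ Finset.range n, b m) ≠ 0 := (bot_le.trans_lt hr).ne'
  have hfin : (∑ m ∈ Finset.range n, b m) ≠ ∞ := (ENNReal.sum_lt_top.2 fun i _ => (hb i).lt_top).ne
  have := h2 (r / ∑ m ∈ Finset.range n, b m) (by
    rw [ENNReal.div_lt_iff (Or.inl hpos) (Or.inl hfin)]; simpa using hr)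
  rwa [ENNReal.div_mul_cancel hpos hfin] at this

theorem SchurWavelet.tsum_rpow_mul_rpow_le {ι : Type*} (f g : ι → ℝ≥0∞) {q r : ℝ} (hq : 0 ≤ q)
    (hr : 0 ≤ r) (hqr : q + r = 1) :
    ∑' i, f i ^ q * g i ^ r ≤ (∑' i, f i) ^ q * (∑' i, g i) ^ r := by
  let _ : MeasurableSpace ι := ⊤
  have := ENNReal.lintegral_mul_norm_pow_le (μ := Measure.count) (f := f) (g := g)
    measurable_from_top.aemeasurable measurable_from_top.aemeasurable hq hr hqr
  simpa [lintegral_count] using this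

theorem SchurWavelet.tsum_enorm_inner_sq {H ι : Type*} [NormedAddCommGroup H]
    [InnerProductSpace ℂ H] [CompleteSpace H] (w : HilbertBasis ι ℂ H) (y : H) :
    ∑' i, ‖⟪w i, y⟫_ℂ‖ₑ ^ 2 = ‖y‖ₑ ^ 2 := by
  have h : HasSum (fun i => RCLike.re (⟪y, w i⟫_ℂ * ⟪w i, y⟫_ℂ)) (RCLike.re ⟪y, y⟫_ℂ) :=
    Complex.reCLM.hasSum (w.hasSum_inner_mul_inner y y)
  have h2 : HasSum (fun i => ‖⟪w i, y⟫_ℂ‖ ^ 2) (‖y‖ ^ 2) := by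
    rw [norm_sq_eq_re_inner (𝕜 := ℂ)]
    refine h.congr_fun fun i => ?_
    rw [inner_mul_symm_re_eq_norm, norm_mul, norm_inner_symm, sq]
  have h3 := ENNReal.ofReal_tsum_of_nonneg (fun i => sq_nonneg ‖⟪w i, y⟫_ℂ‖) h2.summable
  rw [h2.tsum_eq] at h3
  simpa [ENNReal.ofReal_pow, ofReal_norm] using h3.symm

/-- Simultaneous diagonalization of the quadratic form `y ↦ ∑ ‖D_l y‖²`. -/
theorem SchurWavelet.exists_hilbertBasis_diagonal.{u} {H : Type u} {σ : Type*}
    [NormedAddCommGroup H] [InnerProductSpace ℂ H] [CompleteSpace H] (L : Finset σ)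
    (D : σ → H →L[ℂ] H)
    (hD : ∀ l ∈ L, IsCompactOperator (ContinuousLinearMap.adjoint (D l) ∘L D l)) :
    ∃ (ι : Type u) (w : HilbertBasis ι ℂ H) (c : ι → ℝ≥0),
      ∀ y, ∑ l ∈ L, ‖D l y‖ₑ ^ 2 = ∑' i, (c i : ℝ≥0∞) * ‖⟪w i, y⟫_ℂ‖ₑ ^ 2 := by
  set K : H →L[ℂ] H := ∑ l ∈ L, ContinuousLinearMap.adjoint (D l) ∘L D l with hKdef
  have hK : K.IsPositive := ContinuousLinearMap.isPositive_sum _ fun l _ =>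
    ContinuousLinearMap.isPositive_adjoint_comp_self _
  have hc : IsCompactOperator K :=
    (compactOperator (RingHom.id ℂ) H H).sum_mem (t := L) hD
  obtain ⟨ι, w, c, hc0, hw⟩ := SchurWavelet.exists_hilbertBasis_eigenvectors hK hc
  refine ⟨ι, w, fun i => ⟨c i, hc0 i⟩, fun y => ?_⟩
  have hsum : HasSum (fun i => c i * ‖⟪w i, y⟫_ℂ‖ ^ 2) (∑ l ∈ L, ‖D l y‖ ^ 2) := by
    have h : HasSum (fun i => (⟪K y, w i⟫_ℂ * ⟪w i, y⟫_ℂ).re) (RCLike.re ⟪K y, y⟫_ℂ) :=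
      Complex.reCLM.hasSum (w.hasSum_inner_mul_inner (K y) y)
    have hval : RCLike.re ⟪K y, y⟫_ℂ = ∑ l ∈ L, ‖D l y‖ ^ 2 := by
      rw [hKdef, sum_apply, sum_inner, map_sum]
      refine Finset.sum_congr rfl fun l _ => ?_
      rw [ContinuousLinearMap.comp_apply, ContinuousLinearMap.adjoint_inner_left,
        ← norm_sq_eq_re_inner (𝕜 := ℂ)]
    rw [← hval]
    refine h.congr_fun fun i => ?_
    rw [hK.inner_left_eq_inner_right, hw, inner_smul_right, mul_assoc, Complex.re_ofReal_mul]
    congr 1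
    change _ = RCLike.re (⟪y, w i⟫_ℂ * ⟪w i, y⟫_ℂ)
    rw [inner_mul_symm_re_eq_norm, norm_mul, norm_inner_symm, sq]
  have h3 := ENNReal.ofReal_tsum_of_nonneg (fun i => mul_nonneg (hc0 i) (sq_nonneg _)) hsum.summable
  rw [hsum.tsum_eq, ENNReal.ofReal_sum_of_nonneg fun l _ => sq_nonneg _] at h3
  simp only [ENNReal.ofReal_pow (norm_nonneg _), ofReal_norm, ENNReal.ofReal_mul (hc0 _)] at h3
  rw [h3]
  refine tsum_congr fun i => ?_
  rw [ENNReal.ofReal_eq_coe_nnreal (hc0 i)]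
  rfl

/-- Concavity of `x ^ q` compares the eigenvalues `c` of `∑ h_α ⊗ h_α` with the lengths of the
vectors `h_α`. -/
theorem SchurWavelet.tsum_eigenvalue_rpow_le {H ι α : Type*} [NormedAddCommGroup H]
    [InnerProductSpace ℂ H] [CompleteSpace H] (w : HilbertBasis ι ℂ H) (c : ι → ℝ≥0) (h : α → H)
    (hh : ∀ y, ∑' a, ‖⟪h a, y⟫_ℂ‖ₑ ^ 2 = ∑' i, (c i : ℝ≥0∞) * ‖⟪w i, y⟫_ℂ‖ₑ ^ 2)
    {q : ℝ} (hq : 0 < q) (hq1 : q < 1) :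
    ∑' i, (c i : ℝ≥0∞) ^ q ≤ ∑' a, ‖h a‖ₑ ^ (2 * q) := by
  classical
  have hfin : ∀ (l : ι → ℂ) (F : Finset ι),
      ∑' i, (c i : ℝ≥0∞) * ‖⟪w i, ∑ i ∈ F, l i • w i⟫_ℂ‖ₑ ^ 2
        = ∑ i ∈ F, (c i : ℝ≥0∞) * ‖l i‖ₑ ^ 2 := by
    intro l F
    rw [tsum_eq_sum (s := F)]
    · refine Finset.sum_congr rfl fun i hi => ?_
      rw [w.orthonormal.inner_right_sum l hi]
    · intro i hi
      have : ⟪w i, ∑ i ∈ F, l i • w i⟫_ℂ = 0 := by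
        rw [inner_sum]
        refine Finset.sum_eq_zero fun m hm => ?_
        rw [inner_smul_right, w.orthonormal.2 (ne_of_mem_of_not_mem hm hi).symm, mul_zero]
      rw [this]; simp
  -- The eigenvalue is recovered by testing the quadratic form at `w i`.
  have hsum : ∀ i, ∑' a, ‖⟪h a, w i⟫_ℂ‖ₑ ^ 2 = c i := by
    intro i
    have := hfin (fun _ => 1) {i}
    rw [← hh] at this
    simpa using this
  -- This expresses `h a ⊗ h a ≤ K`, where `K` is the operator with eigenvalues `c`: formally, `⟪h
  -- a, K⁻¹ h a⟫ ≤ 1`. Terms with `c i = 0` vanish, since `0 / 0 = 0`.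
  have hbessel : ∀ a, ∑' i, ‖⟪h a, w i⟫_ℂ‖ₑ ^ 2 / c i ≤ 1 := by
    intro a
    rw [ENNReal.tsum_eq_iSup_sum]
    refine iSup_le fun F => ?_
    have hzero : ∀ i, c i = 0 → ⟪h a, w i⟫_ℂ = 0 := by
      intro i hi
      have h1 := ENNReal.le_tsum (f := fun a => ‖⟪h a, w i⟫_ℂ‖ₑ ^ 2) a
      rw [hsum, hi] at h1
      simpa using h1
    set S : ℝ≥0 := ∑ i ∈ F, ‖⟪h a, w i⟫_ℂ‖₊ ^ 2 / c i with hS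
    have hSe : ∑ i ∈ F, ‖⟪h a, w i⟫_ℂ‖ₑ ^ 2 / c i = (S : ℝ≥0∞) := by
      rw [hS, ENNReal.ofNNReal_finsetSum]
      refine Finset.sum_congr rfl fun i _ => ?_
      rcases eq_or_ne (c i) 0 with h0 | h0
      · simp [h0, hzero i h0]
      · rw [ENNReal.coe_div h0, ENNReal.coe_pow]; rfl
    -- Coefficients of a truncated `K⁻¹ (h a)`. At this vector both `⟪h a, ·⟫` and the quadratic
    -- form of `K` equal `S`, whence `S² ≤ S`.
    let l : ι → ℂ := fun i => (starRingEnd ℂ ⟪h a, w i⟫_ℂ) / (c i : ℝ)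
    have h1 : ⟪h a, ∑ i ∈ F, l i • w i⟫_ℂ = ((S : ℝ) : ℂ) := by
      rw [inner_sum, hS]
      push_cast
      refine Finset.sum_congr rfl fun i _ => ?_
      rw [inner_smul_right, div_mul_eq_mul_div, RCLike.conj_mul]
      simp
    have h2 : ∑ i ∈ F, (c i : ℝ≥0∞) * ‖l i‖ₑ ^ 2 = (S : ℝ≥0∞) := by
      rw [hS, ENNReal.ofNNReal_finsetSum]
      refine Finset.sum_congr rfl fun i _ => ?_
      rw [enorm_eq_nnnorm, ← ENNReal.coe_pow, ← ENNReal.coe_mul]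
      congr 1
      have : ‖l i‖₊ = ‖⟪h a, w i⟫_ℂ‖₊ / c i := by
        ext
        simp [l, norm_inner_symm (w i)]
      rw [this]
      rcases eq_or_ne (c i) 0 with h0 | h0
      · simp [h0]
      · field_simp
    have h3 : (S : ℝ≥0∞) ^ 2 ≤ S := by
      have h4 := ENNReal.le_tsum (f := fun a => ‖⟪h a, ∑ i ∈ F, l i • w i⟫_ℂ‖ₑ ^ 2) a
      rw [hh, hfin, h2] at h4
      simp only [h1] at h4
      simpa [enorm_eq_nnnorm] using h4
    rw [hSe]
    norm_cast at h3 ⊢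
    by_contra! hlt
    have : S * 1 < S * S := mul_lt_mul_of_pos_left hlt (one_pos.trans hlt)
    rw [← sq, mul_one] at this
    exact absurd h3 (not_le.2 this)
  -- Write `c i ^ q = c i · c i ^ (q - 1)`, expand the first factor by `hsum`, and split each term
  -- for Hölder in `i`.
  have h1 : ∀ i, (c i : ℝ≥0∞) ^ q ≤
      ∑' a, (‖⟪h a, w i⟫_ℂ‖ₑ ^ 2) ^ q * (‖⟪h a, w i⟫_ℂ‖ₑ ^ 2 / c i) ^ (1 - q) := by
    intro i
    rcases eq_or_ne (c i) 0 with h0 | h0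
    · simp [h0, hq]
    · have hc0 : (c i : ℝ≥0∞) ≠ 0 := by simpa using h0
      have : ∀ a, (‖⟪h a, w i⟫_ℂ‖ₑ ^ 2) ^ q * (‖⟪h a, w i⟫_ℂ‖ₑ ^ 2 / c i) ^ (1 - q)
          = ‖⟪h a, w i⟫_ℂ‖ₑ ^ 2 * ((c i : ℝ≥0∞) ^ (1 - q))⁻¹ := by
        intro a
        rw [ENNReal.div_rpow_of_nonneg _ _ (by linarith), div_eq_mul_inv, ← mul_assoc,
          ← ENNReal.rpow_add_of_nonneg _ _ hq.le (by linarith)]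
        simp
      simp_rw [this]
      rw [ENNReal.tsum_mul_right, hsum, ← ENNReal.rpow_neg]
      nth_rewrite 2 [← ENNReal.rpow_one (c i : ℝ≥0∞)]
      rw [← ENNReal.rpow_add _ _ hc0 ENNReal.coe_ne_top]
      simp
  calc ∑' i, (c i : ℝ≥0∞) ^ q
      ≤ ∑' i, ∑' a, (‖⟪h a, w i⟫_ℂ‖ₑ ^ 2) ^ q * (‖⟪h a, w i⟫_ℂ‖ₑ ^ 2 / c i) ^ (1 - q) :=
        ENNReal.tsum_le_tsum h1
    _ = ∑' a, ∑' i, (‖⟪h a, w i⟫_ℂ‖ₑ ^ 2) ^ q * (‖⟪h a, w i⟫_ℂ‖ₑ ^ 2 / c i) ^ (1 - q) :=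
        ENNReal.tsum_comm
    _ ≤ ∑' a, ‖h a‖ₑ ^ (2 * q) := by
        refine ENNReal.tsum_le_tsum fun a => ?_
        refine (SchurWavelet.tsum_rpow_mul_rpow_le _ _ hq.le (by linarith) (by ring)).trans ?_
        have h5 : ∑' i, ‖⟪h a, w i⟫_ℂ‖ₑ ^ 2 = ‖h a‖ₑ ^ 2 := by
          rw [← SchurWavelet.tsum_enorm_inner_sq w]
          refine tsum_congr fun i => ?_
          rw [← ofReal_norm, norm_inner_symm, ofReal_norm]
        rw [h5]
        calc _ ≤ (‖h a‖ₑ ^ 2) ^ q * 1 ^ (1 - q) :=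
              mul_le_mul_right (ENNReal.rpow_le_rpow (hbessel a) (by linarith)) _
          _ = _ := by
              rw [ENNReal.one_rpow, mul_one, ENNReal.rpow_mul]
              norm_cast

/-! ### Singular values and quadratic forms -/

section Singular

variable {H : Type*} [NormedAddCommGroup H] [InnerProductSpace ℂ H]

theorem SchurWavelet.singularValue_le_enorm (n : ℕ) (T : H →L[ℂ] H) :
    SchurWavelet.singularValue n T ≤ ‖T‖ₑ := by
  refine (iInf₂_le (0 : H →L[ℂ] H) ?_).trans (by simp)
  simp

theorem SchurWavelet.singularValue_ne_top (n : ℕ) (T : H →L[ℂ] H) :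
    SchurWavelet.singularValue n T ≠ ∞ :=
  ((SchurWavelet.singularValue_le_enorm n T).trans_lt enorm_lt_top).ne

theorem SchurWavelet.singularValue_le_add (n : ℕ) (S T : H →L[ℂ] H) :
    SchurWavelet.singularValue n T ≤ SchurWavelet.singularValue n S + ‖T - S‖ₑ := by
  rw [SchurWavelet.singularValue, SchurWavelet.singularValue, ENNReal.iInf_add]
  refine le_iInf fun R => ?_
  rw [ENNReal.iInf_add]
  refine le_iInf fun hR => (iInf₂_le R hR).trans ?_
  calc ‖T - R‖ₑ = ‖(S - R) + (T - S)‖ₑ := by congr 1; abel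
    _ ≤ ‖S - R‖ₑ + ‖T - S‖ₑ := by
        simpa only [enorm_eq_nnnorm, ← ENNReal.coe_add, ENNReal.coe_le_coe] using
          nnnorm_add_le (S - R) (T - S)

theorem SchurWavelet.tendsto_singularValue {n : ℕ} {u : ℕ → H →L[ℂ] H} {T : H →L[ℂ] H}
    (h : Filter.Tendsto (fun m => ‖T - u m‖ₑ) Filter.atTop (nhds 0)) :
    Filter.Tendsto (fun m => SchurWavelet.singularValue n (u m)) Filter.atTop
      (nhds (SchurWavelet.singularValue n T)) := by
  have h1 : Filter.Tendsto (fun m => SchurWavelet.singularValue n T - ‖T - u m‖ₑ) Filter.atTop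
      (nhds (SchurWavelet.singularValue n T)) := by
    simpa using ENNReal.Tendsto.sub (tendsto_const_nhds (x := SchurWavelet.singularValue n T)) h
      (Or.inr ENNReal.zero_ne_top)
  have h2 : Filter.Tendsto (fun m => SchurWavelet.singularValue n T + ‖T - u m‖ₑ) Filter.atTop
      (nhds (SchurWavelet.singularValue n T)) := by
    simpa using (tendsto_const_nhds (x := SchurWavelet.singularValue n T)).add h
  refine tendsto_of_tendsto_of_tendsto_of_le_of_le h1 h2 (fun m => ?_) fun m => ?_
  · exact tsub_le_iff_right.2 (SchurWavelet.singularValue_le_add n (u m) T)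
  · have := SchurWavelet.singularValue_le_add n T (u m)
    rwa [← enorm_neg, neg_sub] at this

/-- Each singular value is norm continuous, so the power sum is lower semicontinuous; this carries
bounds for finite sums of tensors to their limit. -/
theorem SchurWavelet.tsum_singularValue_rpow_le_of_tendsto {p : ℝ} {u : ℕ → H →L[ℂ] H}
    {T : H →L[ℂ] H} {D : ℝ≥0∞}
    (h : Filter.Tendsto (fun m => ‖T - u m‖ₑ) Filter.atTop (nhds 0))
    (hu : ∀ m, ∑' n, SchurWavelet.singularValue n (u m) ^ p ≤ D) :
    ∑' n, SchurWavelet.singularValue n T ^ p ≤ D := by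
  rw [ENNReal.tsum_eq_iSup_sum]
  refine iSup_le fun F => ?_
  refine le_of_tendsto' (tendsto_finsetSum F fun n _ =>
    (ENNReal.continuous_rpow_const.tendsto _).comp (SchurWavelet.tendsto_singularValue h))
    fun m => (ENNReal.sum_le_tsum F).trans (hu m)

theorem SchurWavelet.isCompactOperator_of_rank_le {R : H →L[ℂ] H} {n : ℕ}
    (hR : (R : H →ₗ[ℂ] H).rank ≤ n) : IsCompactOperator R := by
  have hfd : FiniteDimensional ℂ (LinearMap.range (R : H →ₗ[ℂ] H)) :=
    Module.rank_lt_aleph0_iff.1 (hR.trans_lt (Cardinal.natCast_lt_aleph0))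
  have : ProperSpace (LinearMap.range (R : H →ₗ[ℂ] H)) := FiniteDimensional.proper ℂ _
  let R' : H →L[ℂ] LinearMap.range (R : H →ₗ[ℂ] H) :=
    R.codRestrict _ fun x => LinearMap.mem_range_self (R : H →ₗ[ℂ] H) x
  have h1 : IsCompactOperator (LinearMap.range (R : H →ₗ[ℂ] H)).subtypeL := by
    refine ⟨_, (isCompact_closedBall (0 : LinearMap.range (R : H →ₗ[ℂ] H)) 1).image
      (LinearMap.range (R : H →ₗ[ℂ] H)).subtypeL.continuous, ?_⟩
    filter_upwards [Metric.closedBall_mem_nhds (0 : LinearMap.range (R : H →ₗ[ℂ] H)) one_pos] with x hx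
    exact ⟨x, hx, rfl⟩
  exact h1.comp_clm R'

variable [CompleteSpace H]

/-- Summability forces the singular values to `0`, so `A` is a norm limit of finite-rank operators.
Compactness is what permits diagonalization. -/
theorem SchurWavelet.isCompactOperator_of_tsum_ne_top {p : ℝ} (hp : 0 < p) {A : H →L[ℂ] H}
    (hA : ∑' n, SchurWavelet.singularValue n A ^ p ≠ ∞) : IsCompactOperator A := by
  have hmem : A ∈ closure {f : H →L[ℂ] H | IsCompactOperator f} := by
    rw [Metric.mem_closure_iff]
    intro ε hε
    have h0 := ENNReal.tendsto_atTop_zero_of_tsum_ne_top hA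
    have hε' : (0 : ℝ≥0∞) < ENNReal.ofReal ε ^ p :=
      ENNReal.rpow_pos (by simpa using hε) ENNReal.ofReal_ne_top
    obtain ⟨n, hn⟩ := (h0.eventually_lt_const hε').exists
    have hlt : SchurWavelet.singularValue n A < ENNReal.ofReal ε :=
      (ENNReal.rpow_lt_rpow_iff hp).1 hn
    rw [SchurWavelet.singularValue] at hlt
    simp only [iInf_lt_iff] at hlt
    obtain ⟨R, hR, hlt⟩ := hlt
    refine ⟨R, SchurWavelet.isCompactOperator_of_rank_le hR, ?_⟩
    rw [dist_eq_norm]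
    rwa [← ofReal_norm, ENNReal.ofReal_lt_ofReal_iff hε] at hlt
  rwa [isClosed_setOfPred_isCompactOperator.closure_eq] at hmem

theorem SchurWavelet.enorm_adjoint (T : H →L[ℂ] H) : ‖adjoint T‖ₑ = ‖T‖ₑ := by
  rw [← ofReal_norm, LinearIsometryEquiv.norm_map, ofReal_norm]

/-- Cutting `T` down by the span of finitely many eigenvectors bounds its singular values. -/
theorem SchurWavelet.singularValue_le_of_card_le {ι : Type*} (w : HilbertBasis ι ℂ H)
    (c : ι → ℝ≥0∞) {T : H →L[ℂ] H}
    (hT : ∀ y, ‖adjoint T y‖ₑ ^ 2 ≤ ∑' i, c i * ‖⟪w i, y⟫_ℂ‖ₑ ^ 2)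
    {F : Finset ι} {n : ℕ} (hF : F.card ≤ n) {t : ℝ≥0} (ht : ∀ i ∉ F, c i ≤ (t : ℝ≥0∞) ^ 2) :
    SchurWavelet.singularValue n T ≤ t := by
  classical
  let U : Submodule ℂ H := Submodule.span ℂ (F.image w : Finset H)
  let P : H →L[ℂ] H := U.starProjection
  have hrank : ((P ∘L T : H →L[ℂ] H) : H →ₗ[ℂ] H).rank ≤ n := by
    refine (LinearMap.rank_comp_le_left (T : H →ₗ[ℂ] H) (P : H →ₗ[ℂ] H)).trans ?_
    have h1 : LinearMap.range (P : H →ₗ[ℂ] H) ≤ U := by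
      rintro _ ⟨x, rfl⟩
      exact U.starProjection_apply_mem x
    refine (Submodule.rank_mono h1).trans ((rank_span_finset_le _).trans ?_)
    exact_mod_cast Finset.card_image_le.trans hF
  refine (iInf₂_le (P ∘L T) hrank).trans ?_
  rw [← SchurWavelet.enorm_adjoint, enorm_eq_nnnorm, ENNReal.coe_le_coe]
  refine ContinuousLinearMap.opNNNorm_le_bound _ _ fun y => ?_
  have hPs : ∀ x y, ⟪x, P y⟫_ℂ = ⟪P x, y⟫_ℂ := fun x y =>
    (Submodule.inner_starProjection_left_eq_right U x y).symm
  -- The competitor of rank at most `n` is `P T`; on the adjoint side the error sees only the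
  -- components of `y` off `F`.
  have hadj : adjoint (T - P ∘L T) y = adjoint T (y - P y) := by
    refine ext_inner_left ℂ fun x => ?_
    rw [ContinuousLinearMap.adjoint_inner_right, ContinuousLinearMap.adjoint_inner_right,
      inner_sub_right, hPs]
    simp [inner_sub_left]
  rw [hadj, ← ENNReal.coe_le_coe, ENNReal.coe_mul, ← enorm_eq_nnnorm, ← enorm_eq_nnnorm]
  have hmem : ∀ i ∈ F, P (w i) = w i := fun i hi =>
    Submodule.starProjection_eq_self_iff.2
      (Submodule.subset_span (Finset.mem_coe.2 (Finset.mem_image_of_mem _ hi)))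
  have hnot : ∀ i ∉ F, P (w i) = 0 := by
    intro i hi
    rw [Submodule.starProjection_apply_eq_zero_iff, Submodule.mem_orthogonal]
    intro u hu
    induction hu using Submodule.span_induction with
    | mem x hx =>
      obtain ⟨m, hm, rfl⟩ := Finset.mem_image.1 (Finset.mem_coe.1 hx)
      exact w.orthonormal.2 (ne_of_mem_of_not_mem hm hi)
    | zero => simp
    | add x y _ _ hx hy => rw [inner_add_left, hx, hy, add_zero]
    | smul a x _ hx => rw [inner_smul_left, hx, mul_zero]
  have hsq : ‖adjoint T (y - P y)‖ₑ ^ 2 ≤ (t * ‖y‖ₑ) ^ 2 := by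
    refine (hT _).trans ?_
    rw [mul_pow, ← SchurWavelet.tsum_enorm_inner_sq w y, ← ENNReal.tsum_mul_left]
    refine ENNReal.tsum_le_tsum fun i => ?_
    rw [inner_sub_right, hPs]
    by_cases hi : i ∈ F
    · simp [hmem i hi]
    · rw [hnot i hi, inner_zero_left, sub_zero]
      gcongr
      exact ht i hi
  exact (ENNReal.pow_le_pow_left_iff two_ne_zero).1 hsq

theorem SchurWavelet.tsum_singularValue_rpow_le {ι : Type*} (w : HilbertBasis ι ℂ H)
    (c : ι → ℝ≥0∞) {T : H →L[ℂ] H}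
    (hT : ∀ y, ‖adjoint T y‖ₑ ^ 2 ≤ ∑' i, c i * ‖⟪w i, y⟫_ℂ‖ₑ ^ 2) {p : ℝ} (hp : 0 < p) :
    ∑' n, SchurWavelet.singularValue n T ^ p ≤ ∑' i, c i ^ (p / 2) := by
  refine SchurWavelet.tsum_le_tsum_of_exists_notMem (fun F n hF t ht => ?_) fun n =>
    ENNReal.rpow_ne_top_of_nonneg hp.le (SchurWavelet.singularValue_ne_top n T)
  by_contra! hcon
  have htop : t ≠ ∞ := ne_top_of_lt ht
  have hs : t ^ (1 / p) ≠ ∞ := ENNReal.rpow_ne_top_of_nonneg (by positivity) htop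
  have h1 : SchurWavelet.singularValue n T ≤ (t ^ (1 / p)).toNNReal := by
    refine SchurWavelet.singularValue_le_of_card_le w c hT hF fun i hi => ?_
    rw [ENNReal.coe_toNNReal hs, ← ENNReal.rpow_natCast, ← ENNReal.rpow_mul]
    have h2 := ENNReal.rpow_le_rpow (hcon i hi).le (by positivity : 0 ≤ 2 / p)
    rw [← ENNReal.rpow_mul] at h2
    convert h2 using 1
    · rw [show p / 2 * (2 / p) = 1 by field_simp, ENNReal.rpow_one]
    · congr 1; push_cast; ring
  rw [ENNReal.coe_toNNReal hs] at h1
  have h2 := ENNReal.rpow_le_rpow h1 hp.le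
  rw [← ENNReal.rpow_mul, one_div_mul_cancel hp.ne', ENNReal.rpow_one] at h2
  exact absurd ht (not_lt.2 h2)

/-- Dimension count: the span of `n + 1` vectors `w i` meets `ker R^*`, the orthogonal complement of
the range of `R`, and there `A^*` agrees with `(A - R)^*`. -/
theorem SchurWavelet.le_singularValue {ι : Type*} (w : HilbertBasis ι ℂ H)
    (c : ι → ℝ≥0∞) {A : H →L[ℂ] H}
    (hA : ∀ y, ∑' i, c i * ‖⟪w i, y⟫_ℂ‖ₑ ^ 2 ≤ ‖adjoint A y‖ₑ ^ 2)
    {F : Finset ι} {n : ℕ} (hF : F.card = n + 1) {t : ℝ≥0∞} (ht : ∀ i ∈ F, t ^ 2 ≤ c i) :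
    t ≤ SchurWavelet.singularValue n A := by
  classical
  refine le_iInf₂ fun R hR => ?_
  let U : Submodule ℂ H := Submodule.span ℂ (F.image w : Finset H)
  let V : Submodule ℂ H := LinearMap.range (R : H →ₗ[ℂ] H)
  have hVfd : FiniteDimensional ℂ V :=
    Module.rank_lt_aleph0_iff.1 (hR.trans_lt (Cardinal.natCast_lt_aleph0))
  have hV : Module.finrank ℂ V ≤ n := Module.finrank_le_of_rank_le hR
  have hU : Module.finrank ℂ U = n + 1 := by
    have hinj : (F.image w).card = n + 1 := by
      rw [Finset.card_image_of_injective _ w.orthonormal.linearIndependent.injective, hF]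
    rw [← hinj]
    refine finrank_span_finset_eq_card ?_
    have := w.orthonormal.linearIndependent.linearIndepOn_id
    exact this.mono (by simp)
  have hker := LinearMap.ker_ne_bot_of_finrank_lt
    (f := (V.orthogonalProjectionOnto : H →L[ℂ] V).toLinearMap ∘ₗ U.subtype) (by omega)
  obtain ⟨x, hx, hx0⟩ := Submodule.exists_mem_ne_zero_of_ne_bot hker
  have hxV : (x : H) ∈ Vᗮ := by
    rw [← Submodule.orthogonalProjectionOnto_eq_zero_iff]
    simpa using hx
  have hRx : adjoint R (x : H) = 0 := by
    refine ext_inner_left ℂ fun z => ?_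
    rw [ContinuousLinearMap.adjoint_inner_right, inner_zero_right]
    exact (Submodule.mem_orthogonal _ _).1 hxV _ (LinearMap.mem_range_self (R : H →ₗ[ℂ] H) z)
  have hnot : ∀ i ∉ F, ⟪w i, (x : H)⟫_ℂ = 0 := by
    intro i hi
    obtain ⟨x, hxU⟩ := x
    clear hx hx0 hxV hRx
    change ⟪w i, x⟫_ℂ = 0
    induction hxU using Submodule.span_induction with
    | mem x hx =>
      obtain ⟨m, hm, rfl⟩ := Finset.mem_image.1 (Finset.mem_coe.1 hx)
      exact w.orthonormal.2 (ne_of_mem_of_not_mem hm hi).symm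
    | zero => simp
    | add x y _ _ hx hy => rw [inner_add_right, hx, hy, add_zero]
    | smul a x _ hx => rw [inner_smul_right, hx, mul_zero]
  have hsq : (t * ‖(x : H)‖ₑ) ^ 2 ≤ (‖A - R‖ₑ * ‖(x : H)‖ₑ) ^ 2 := by
    calc (t * ‖(x : H)‖ₑ) ^ 2 = ∑' i, t ^ 2 * ‖⟪w i, (x : H)⟫_ℂ‖ₑ ^ 2 := by
          rw [mul_pow, ← SchurWavelet.tsum_enorm_inner_sq w, ENNReal.tsum_mul_left]
      _ ≤ ∑' i, c i * ‖⟪w i, (x : H)⟫_ℂ‖ₑ ^ 2 := by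
          refine ENNReal.tsum_le_tsum fun i => ?_
          by_cases hi : i ∈ F
          · gcongr
            exact ht i hi
          · simp [hnot i hi]
      _ ≤ ‖adjoint A (x : H)‖ₑ ^ 2 := hA _
      _ = ‖adjoint (A - R) (x : H)‖ₑ ^ 2 := by
          rw [map_sub, sub_apply, hRx, sub_zero]
      _ ≤ _ := by
          gcongr
          rw [← SchurWavelet.enorm_adjoint (A - R)]
          exact (adjoint (A - R)).le_opENorm _
  have h3 := (ENNReal.pow_le_pow_left_iff two_ne_zero).1 hsq
  exact (ENNReal.mul_le_mul_iff_left (by simpa using hx0) enorm_ne_top).1 h3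

theorem SchurWavelet.tsum_rpow_le_tsum_singularValue {ι : Type*} (w : HilbertBasis ι ℂ H)
    (c : ι → ℝ≥0∞) {A : H →L[ℂ] H}
    (hA : ∀ y, ∑' i, c i * ‖⟪w i, y⟫_ℂ‖ₑ ^ 2 ≤ ‖adjoint A y‖ₑ ^ 2) {p : ℝ} (hp : 0 < p) :
    ∑' i, c i ^ (p / 2) ≤ ∑' n, SchurWavelet.singularValue n A ^ p := by
  refine SchurWavelet.tsum_le_tsum_of_card_le fun F n hF t ht => ?_
  have h1 : t ^ (1 / p) ≤ SchurWavelet.singularValue n A := by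
    refine SchurWavelet.le_singularValue w c hA hF fun i hi => ?_
    have h2 := ENNReal.rpow_le_rpow (ht i hi) (by positivity : 0 ≤ 2 / p)
    rw [← ENNReal.rpow_mul] at h2
    rw [← ENNReal.rpow_natCast, ← ENNReal.rpow_mul]
    convert h2 using 1
    · congr 1; push_cast; ring
    · rw [show p / 2 * (2 / p) = 1 by field_simp, ENNReal.rpow_one]
  have h2 := ENNReal.rpow_le_rpow h1 hp.le
  rwa [← ENNReal.rpow_mul, one_div_mul_cancel hp.ne', ENNReal.rpow_one] at h2

end Singular

/-! ### Schatten estimate for block sums -/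

section BlockSum

variable {H σ : Type*} [NormedAddCommGroup H] [InnerProductSpace ℂ H] [CompleteSpace H]

/-- The column operator `x ↦ (Φ_l x)_l` has squared norm at most `B`, hence so does its adjoint;
pair the sum with itself and apply Cauchy–Schwarz. -/
theorem SchurWavelet.norm_sum_adjoint_sq_le {L : Finset σ} {Φ : σ → H →L[ℂ] H} {B : ℝ≥0}
    (hΦ : ∀ x, ∑ l ∈ L, ‖Φ l x‖ ^ 2 ≤ B * ‖x‖ ^ 2) (v : σ → H) :
    ‖∑ l ∈ L, adjoint (Φ l) (v l)‖ ^ 2 ≤ B * ∑ l ∈ L, ‖v l‖ ^ 2 := by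
  set u := ∑ l ∈ L, adjoint (Φ l) (v l) with hu
  have h1 : ‖u‖ ^ 2 ≤ ∑ l ∈ L, ‖Φ l u‖ * ‖v l‖ := by
    rw [norm_sq_eq_re_inner (𝕜 := ℂ)]
    nth_rewrite 2 [hu]
    rw [inner_sum, map_sum]
    refine Finset.sum_le_sum fun l _ => ?_
    rw [ContinuousLinearMap.adjoint_inner_right]
    exact re_inner_le_norm _ _
  have h2 : (‖u‖ ^ 2) ^ 2 ≤ (B * ‖u‖ ^ 2) * ∑ l ∈ L, ‖v l‖ ^ 2 := by
    calc (‖u‖ ^ 2) ^ 2 ≤ (∑ l ∈ L, ‖Φ l u‖ * ‖v l‖) ^ 2 := by gcongr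
      _ ≤ (∑ l ∈ L, ‖Φ l u‖ ^ 2) * ∑ l ∈ L, ‖v l‖ ^ 2 := Finset.sum_mul_sq_le_sq_mul_sq _ _ _
      _ ≤ _ := by
        gcongr
        exact hΦ u
  rcases (sq_nonneg ‖u‖).eq_or_lt with h0 | h0
  · rw [← h0]; positivity
  · refine le_of_mul_le_mul_right ?_ h0
    calc _ = (‖u‖ ^ 2) ^ 2 := by ring
      _ ≤ _ := h2
      _ = _ := by ring

/-- The Schatten bound for `∑ M_l A S_l Φ_l` when the `Φ_l` and the `S_l^*` have bounded overlap. -/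
theorem SchurWavelet.tsum_singularValue_sum_le {L : Finset σ} {A : H →L[ℂ] H}
    {M S Φ : σ → H →L[ℂ] H} {κ : σ → ℝ≥0∞} {B N : ℝ≥0}
    (hM : ∀ l ∈ L, ∀ x, ‖M l x‖ₑ ≤ κ l * ‖x‖ₑ)
    (hS : ∀ x, ∑ l ∈ L, ‖adjoint (S l) x‖ₑ ^ 2 ≤ N * ‖x‖ₑ ^ 2)
    (hΦ : ∀ x, ∑ l ∈ L, ‖Φ l x‖ ^ 2 ≤ B * ‖x‖ ^ 2)
    {p : ℝ} (hp : 0 < p) (hp2 : p < 2)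
    (hA : ∑' n, SchurWavelet.singularValue n A ^ p ≠ ∞) :
    ∑' n, SchurWavelet.singularValue n (∑ l ∈ L, M l ∘L A ∘L S l ∘L Φ l) ^ p ≤
      ((B : ℝ≥0∞) ^ (p / 2) * (N : ℝ≥0∞) ^ (p / 2) *
        (∑ l ∈ L, κ l ^ SchurWavelet.flat p) ^ (1 - p / 2)) *
        ∑' n, SchurWavelet.singularValue n A ^ p := by
  have hq : 0 < p / 2 := by positivity
  have hq1 : p / 2 < 1 := by linarith
  have hpq : ∀ x : ℝ≥0∞, (x ^ 2) ^ (p / 2) = x ^ p := by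
    intro x
    rw [← ENNReal.rpow_natCast, ← ENNReal.rpow_mul]
    congr 1; push_cast; ring
  have hflat : ∀ x : ℝ≥0∞, (x ^ SchurWavelet.flat p) ^ (1 - p / 2) = x ^ p := by
    intro x
    rw [← ENNReal.rpow_mul, SchurWavelet.flat]
    congr 1
    have : 2 - p ≠ 0 := by linarith
    field_simp
  have hAc : IsCompactOperator A := SchurWavelet.isCompactOperator_of_tsum_ne_top hp hA
  let Y : σ → H →L[ℂ] H := fun l => A ∘L S l
  have hYc : ∀ l, IsCompactOperator (Y l) := fun l => hAc.comp_clm (S l)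
  -- `e` is an eigenbasis of `A A^*`, so `‖A^* e_i‖² = c₀ i`.
  obtain ⟨ι₀, e, c₀, he⟩ := SchurWavelet.exists_hilbertBasis_diagonal {()} (fun _ => adjoint A)
    (fun _ _ => by
      rw [ContinuousLinearMap.adjoint_adjoint]
      exact hAc.comp_clm (adjoint A))
  simp only [Finset.sum_singleton] at he
  have hA' : ∑' i, ‖adjoint A (e i)‖ₑ ^ p ≤ ∑' n, SchurWavelet.singularValue n A ^ p := by
    refine le_trans (le_of_eq (tsum_congr fun i => ?_))
      (SchurWavelet.tsum_rpow_le_tsum_singularValue e (fun i => (c₀ i : ℝ≥0∞))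
        (fun y => (he y).ge) hp)
    rw [← hpq, he, tsum_eq_single i fun m hm => ?_]
    · rw [← ofReal_norm, inner_self_eq_norm_sq_to_K, e.orthonormal.1]
      simp
    · rw [e.orthonormal.2 hm]; simp
  -- `w` is an eigenbasis of `Y_l^* Y_l`, an operator that also equals `∑ h_i ⊗ h_i` with `h_i =
  -- Y_l^* e_i`; concavity compares the two.
  have hw : ∀ l, ∃ (ι : Type _) (w : HilbertBasis ι ℂ H),
      ∑' i, ‖Y l (w i)‖ₑ ^ p ≤ ∑' i, ‖adjoint (S l) (adjoint A (e i))‖ₑ ^ p := by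
    intro l
    obtain ⟨ι, w, c, hc⟩ := SchurWavelet.exists_hilbertBasis_diagonal {()} (fun _ => Y l)
      (fun _ _ => (hYc l).clm_comp (adjoint (Y l)))
    simp only [Finset.sum_singleton] at hc
    refine ⟨ι, w, ?_⟩
    have hcw : ∀ i, ‖Y l (w i)‖ₑ ^ 2 = c i := by
      intro i
      rw [hc, tsum_eq_single i fun m hm => ?_]
      · rw [← ofReal_norm, inner_self_eq_norm_sq_to_K, w.orthonormal.1]
        simp
      · rw [w.orthonormal.2 hm]; simp
    have hcore := SchurWavelet.tsum_eigenvalue_rpow_le w c (fun i => adjoint (Y l) (e i))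
      (fun y => by
        rw [← hc, ← SchurWavelet.tsum_enorm_inner_sq e]
        simp only [ContinuousLinearMap.adjoint_inner_left]) hq hq1
    simp only [← hcw, hpq] at hcore
    rw [show 2 * (p / 2) = p by ring] at hcore
    refine hcore.trans (le_of_eq (tsum_congr fun i => ?_))
    simp only [Y, ContinuousLinearMap.adjoint_comp, ContinuousLinearMap.comp_apply]
  choose ι w hw using hw
  let X : σ → H →L[ℂ] H := fun l => M l ∘L Y l
  obtain ⟨ι₁, v, c, hc⟩ := SchurWavelet.exists_hilbertBasis_diagonal L (fun l => adjoint (X l))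
    (fun l _ => by
      rw [ContinuousLinearMap.adjoint_adjoint]
      exact ((hYc l).clm_comp (M l)).comp_clm (adjoint (X l)))
  -- Here `∑ X_l X_l^*` is expanded over the vectors `X_l w_{l,i}`, all blocks at once.
  have hcore := SchurWavelet.tsum_eigenvalue_rpow_le v c
    (fun a : Σ l : L, ι l => X a.1 (w a.1 a.2))
    (fun y => by
      rw [← hc, ENNReal.tsum_sigma', ← Finset.tsum_subtype]
      refine tsum_congr fun l => ?_
      rw [← SchurWavelet.tsum_enorm_inner_sq (w l)]
      simp only [ContinuousLinearMap.adjoint_inner_right]) hq hq1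
  rw [show 2 * (p / 2) = p by ring, ENNReal.tsum_sigma',
    Finset.tsum_subtype L fun l => ∑' i, ‖X l (w l i)‖ₑ ^ p] at hcore
  have hT : ∀ y, ‖adjoint (∑ l ∈ L, M l ∘L A ∘L S l ∘L Φ l) y‖ₑ ^ 2 ≤
      ∑' i, ((B : ℝ≥0∞) * c i) * ‖⟪v i, y⟫_ℂ‖ₑ ^ 2 := by
    intro y
    have h1 := SchurWavelet.norm_sum_adjoint_sq_le hΦ fun l => adjoint (X l) y
    have h2 : adjoint (∑ l ∈ L, M l ∘L A ∘L S l ∘L Φ l) y =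
        ∑ l ∈ L, adjoint (Φ l) (adjoint (X l) y) := by
      rw [map_sum, sum_apply]
      refine Finset.sum_congr rfl fun l _ => ?_
      simp only [X, Y, ContinuousLinearMap.adjoint_comp, ContinuousLinearMap.comp_apply]
    simp only [mul_assoc]
    rw [h2, ENNReal.tsum_mul_left, ← hc]
    simp only [enorm_eq_nnnorm]
    norm_cast
    rw [← NNReal.coe_le_coe]
    push_cast
    exact h1
  calc ∑' n, SchurWavelet.singularValue n (∑ l ∈ L, M l ∘L A ∘L S l ∘L Φ l) ^ p
      ≤ ∑' i, ((B : ℝ≥0∞) * c i) ^ (p / 2) := SchurWavelet.tsum_singularValue_rpow_le v _ hT hp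
    _ = (B : ℝ≥0∞) ^ (p / 2) * ∑' i, (c i : ℝ≥0∞) ^ (p / 2) := by
        simp only [ENNReal.mul_rpow_of_nonneg _ _ hq.le]
        rw [ENNReal.tsum_mul_left]
    _ ≤ (B : ℝ≥0∞) ^ (p / 2) * ∑ l ∈ L, ∑' i, ‖X l (w l i)‖ₑ ^ p := by gcongr
    _ ≤ (B : ℝ≥0∞) ^ (p / 2) *
          ∑ l ∈ L, κ l ^ p * ∑' i, ‖adjoint (S l) (adjoint A (e i))‖ₑ ^ p := by
        gcongr with l hl
        refine le_trans ?_ (mul_le_mul_right (hw l) _)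
        rw [← ENNReal.tsum_mul_left]
        refine ENNReal.tsum_le_tsum fun i => ?_
        rw [← ENNReal.mul_rpow_of_nonneg _ _ hp.le]
        exact ENNReal.rpow_le_rpow (hM l hl _) hp.le
    _ = (B : ℝ≥0∞) ^ (p / 2) *
          ∑' i, ∑ l ∈ L, κ l ^ p * ‖adjoint (S l) (adjoint A (e i))‖ₑ ^ p := by
        congr 1
        rw [Summable.tsum_finsetSum fun _ _ => ENNReal.summable]
        simp only [ENNReal.tsum_mul_left]
    _ ≤ (B : ℝ≥0∞) ^ (p / 2) *
          ∑' i, (∑ l ∈ L, κ l ^ SchurWavelet.flat p) ^ (1 - p / 2) *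
            ((N : ℝ≥0∞) ^ (p / 2) * ‖adjoint A (e i)‖ₑ ^ p) := by
        gcongr with i
        -- Hölder over the blocks, for one `e_i` at a time, so that the overlap bound `hS` can be
        -- used on `A^* e_i`.
        have h1 := SchurWavelet.tsum_rpow_mul_rpow_le (fun l : L => κ l ^ SchurWavelet.flat p)
          (fun l : L => ‖adjoint (S l) (adjoint A (e i))‖ₑ ^ 2) (q := 1 - p / 2) (r := p / 2)
          (by linarith) hq.le (by ring)
        simp only [hflat, hpq] at h1
        rw [Finset.tsum_subtype L fun l => κ l ^ p * ‖adjoint (S l) (adjoint A (e i))‖ₑ ^ p,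
          Finset.tsum_subtype L fun l => κ l ^ SchurWavelet.flat p,
          Finset.tsum_subtype L fun l => ‖adjoint (S l) (adjoint A (e i))‖ₑ ^ 2] at h1
        refine h1.trans (mul_le_mul_right ?_ _)
        rw [← hpq ‖adjoint A (e i)‖ₑ, ← ENNReal.mul_rpow_of_nonneg _ _ hq.le]
        exact ENNReal.rpow_le_rpow (hS _) hq.le
    _ = ((B : ℝ≥0∞) ^ (p / 2) * (N : ℝ≥0∞) ^ (p / 2) *
        (∑ l ∈ L, κ l ^ SchurWavelet.flat p) ^ (1 - p / 2)) * ∑' i, ‖adjoint A (e i)‖ₑ ^ p := by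
        rw [ENNReal.tsum_mul_left, ENNReal.tsum_mul_left]
        ring
    _ ≤ _ := by gcongr

end BlockSum

/-! ### Multiplication operators on `L₂(ℝ)` -/

section Multiplication

/-- Multiplication by an essentially bounded function, as an operator on `L₂(ℝ)`. -/
noncomputable def SchurWavelet.mulOp (m : ℝ → ℂ) (hm : MemLp m ∞ volume) :
    Lp ℂ 2 (volume : Measure ℝ) →L[ℂ] Lp ℂ 2 (volume : Measure ℝ) :=
  (ContinuousLinearMap.mul ℂ ℂ).holderL volume ∞ 2 2 (hm.toLp m)

theorem SchurWavelet.coeFn_mulOp {m : ℝ → ℂ} (hm : MemLp m ∞ volume)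
    (g : Lp ℂ 2 (volume : Measure ℝ)) :
    SchurWavelet.mulOp m hm g =ᵐ[volume] fun t => m t * g t := by
  have h1 := ContinuousLinearMap.coeFn_holder (r := 2) (ContinuousLinearMap.mul ℂ ℂ) (hm.toLp m) g
  filter_upwards [h1, hm.coeFn_toLp] with t ht1 ht2
  rw [← ht2]
  exact ht1

theorem SchurWavelet.enorm_sq_eq_lintegral (g : Lp ℂ 2 (volume : Measure ℝ)) :
    ‖g‖ₑ ^ 2 = ∫⁻ t, ‖g t‖ₑ ^ 2 := by
  rw [Lp.enorm_def, eLpNorm_eq_lintegral_rpow_enorm_toReal two_ne_zero ENNReal.ofNat_ne_top,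
    ← ENNReal.rpow_natCast, ← ENNReal.rpow_mul]
  simp

theorem SchurWavelet.enorm_mulOp_le {m : ℝ → ℂ} (hm : MemLp m ∞ volume)
    (g : Lp ℂ 2 (volume : Measure ℝ)) :
    ‖SchurWavelet.mulOp m hm g‖ₑ ≤ eLpNorm m ∞ volume * ‖g‖ₑ := by
  rw [Lp.enorm_def, Lp.enorm_def, eLpNorm_congr_ae (SchurWavelet.coeFn_mulOp hm g)]
  have h := eLpNorm_smul_le_eLpNorm_top_mul_eLpNorm 2 (Lp.aestronglyMeasurable g) m
  rwa [show m • (g : ℝ → ℂ) = fun t => m t * g t from rfl] at h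

theorem SchurWavelet.sum_enorm_mulOp_sq_le {σ : Type*} (L : Finset σ) {m : σ → ℝ → ℂ}
    (hm : ∀ l, MemLp (m l) ∞ volume) {c : ℝ≥0∞}
    (hc : ∀ᵐ t, ∑ l ∈ L, ‖m l t‖ₑ ^ 2 ≤ c) (g : Lp ℂ 2 (volume : Measure ℝ)) :
    ∑ l ∈ L, ‖SchurWavelet.mulOp (m l) (hm l) g‖ₑ ^ 2 ≤ c * ‖g‖ₑ ^ 2 := by
  simp only [SchurWavelet.enorm_sq_eq_lintegral]
  have hg : AEMeasurable (fun t => ‖g t‖ₑ ^ 2) (volume : Measure ℝ) :=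
    (Lp.aestronglyMeasurable g).enorm.pow_const 2
  have h1 : ∀ l ∈ L, ∫⁻ t, ‖SchurWavelet.mulOp (m l) (hm l) g t‖ₑ ^ 2 =
      ∫⁻ t, ‖m l t‖ₑ ^ 2 * ‖g t‖ₑ ^ 2 := by
    intro l _
    refine lintegral_congr_ae ?_
    filter_upwards [SchurWavelet.coeFn_mulOp (hm l) g] with t ht
    rw [ht, enorm_mul, mul_pow]
  rw [Finset.sum_congr rfl h1, ← lintegral_finsetSum', ← lintegral_const_mul'' _ hg]
  · refine lintegral_mono_ae ?_
    filter_upwards [hc] with t ht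
    rw [← Finset.sum_mul]
    gcongr
  · exact fun l _ => ((hm l).1.enorm.pow_const 2).mul hg

theorem SchurWavelet.adjoint_mulOp {m : ℝ → ℂ} (hm : MemLp m ∞ volume)
    (hreal : ∀ t, starRingEnd ℂ (m t) = m t) :
    adjoint (SchurWavelet.mulOp m hm) = SchurWavelet.mulOp m hm := by
  symm
  rw [ContinuousLinearMap.eq_adjoint_iff]
  intro f g
  rw [L2.inner_def, L2.inner_def]
  refine integral_congr_ae ?_
  filter_upwards [SchurWavelet.coeFn_mulOp hm f, SchurWavelet.coeFn_mulOp hm g] with t hf hg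
  rw [hf, hg, RCLike.inner_apply, RCLike.inner_apply, map_mul, hreal]
  ring

end Multiplication

/-! ### Algebra of integral operators -/

section IntegralOp

theorem SchurWavelet.coeFn_integralOp {f : ℝ × ℝ → ℂ} (hf : MemLp f 2 volume)
    (g : Lp ℂ 2 (volume : Measure ℝ)) :
    SchurWavelet.integralOp f hf g =ᵐ[volume] fun y => ∫ x, f (x, y) * g x :=
  MemLp.coeFn_toLp (SchurWavelet.memLp_integral hf (Lp.memLp g)).1

theorem SchurWavelet.enorm_integralOp_le {f : ℝ × ℝ → ℂ} (hf : MemLp f 2 volume) :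
    ‖SchurWavelet.integralOp f hf‖ₑ ≤ eLpNorm f 2 volume := by
  rw [← ofReal_norm]
  exact ENNReal.ofReal_le_of_le_toReal
    (LinearMap.mkContinuous_norm_le _ ENNReal.toReal_nonneg _)

theorem SchurWavelet.integralOp_add {f f' : ℝ × ℝ → ℂ} (hf : MemLp f 2 volume)
    (hf' : MemLp f' 2 volume) (h : MemLp (fun z => f z + f' z) 2 volume) :
    SchurWavelet.integralOp (fun z => f z + f' z) h =
      SchurWavelet.integralOp f hf + SchurWavelet.integralOp f' hf' := by
  ext1 g
  apply Lp.ext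
  rw [add_apply]
  filter_upwards [SchurWavelet.coeFn_integralOp h g, SchurWavelet.coeFn_integralOp hf g,
    SchurWavelet.coeFn_integralOp hf' g, Lp.coeFn_add (SchurWavelet.integralOp f hf g)
      (SchurWavelet.integralOp f' hf' g), SchurWavelet.memLp_slice hf,
    SchurWavelet.memLp_slice hf'] with y h1 h2 h3 h4 h5 h6
  have h7 : Integrable (fun x => f (x, y) * g x) volume := h5.integrable_mul (Lp.memLp g)
  have h8 : Integrable (fun x => f' (x, y) * g x) volume := h6.integrable_mul (Lp.memLp g)
  rw [h1, h4, Pi.add_apply, h2, h3, ← integral_add h7 h8]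
  simp only [add_mul]

theorem SchurWavelet.integralOp_sum {σ : Type*} (L : Finset σ) {f : σ → ℝ × ℝ → ℂ}
    (hf : ∀ l, MemLp (f l) 2 volume) (h : MemLp (fun z => ∑ l ∈ L, f l z) 2 volume) :
    SchurWavelet.integralOp (fun z => ∑ l ∈ L, f l z) h =
      ∑ l ∈ L, SchurWavelet.integralOp (f l) (hf l) := by
  classical
  induction L using Finset.induction_on with
  | empty =>
    have h0 : ‖SchurWavelet.integralOp (fun z => ∑ l ∈ (∅ : Finset σ), f l z) h‖ₑ ≤ 0 :=
      (SchurWavelet.enorm_integralOp_le h).trans (by simp)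
    rw [← ofReal_norm, nonpos_iff_eq_zero, ENNReal.ofReal_eq_zero] at h0
    rw [Finset.sum_empty]
    exact norm_le_zero_iff.1 h0
  | insert l L hl ih =>
    have hL : MemLp (fun z => ∑ l ∈ L, f l z) 2 volume := memLp_finsetSum L fun l _ => hf l
    simp only [Finset.sum_insert hl] at h ⊢
    rw [SchurWavelet.integralOp_add (hf l) hL h, ih]

theorem SchurWavelet.enorm_integralOp_sub_le {f f' : ℝ × ℝ → ℂ} (hf : MemLp f 2 volume)
    (hf' : MemLp f' 2 volume) :
    ‖SchurWavelet.integralOp f hf - SchurWavelet.integralOp f' hf'‖ₑ ≤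
      eLpNorm (fun z => f z - f' z) 2 volume := by
  have hd : MemLp (fun z => f z - f' z) 2 volume := hf.sub hf'
  have hs : MemLp (fun z => f' z + (f z - f' z)) 2 volume := hf'.add hd
  have h1 := SchurWavelet.integralOp_add hf' hd hs
  have h2 : (fun z => f' z + (f z - f' z)) = f := by funext z; ring
  simp only [h2] at h1
  rw [h1, add_sub_cancel_left]
  exact SchurWavelet.enorm_integralOp_le hd

/-- The cutoff `s` equals `1` wherever `a` is nonzero, so inserting it changes nothing here, but it
supplies the localization next to `Op(f)`. -/
theorem SchurWavelet.integralOp_tensor_mul {f : ℝ × ℝ → ℂ} (hf : MemLp f 2 volume)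
    {a s b : ℝ → ℂ} (ha : MemLp a ∞ volume) (hs : MemLp s ∞ volume) (hb : MemLp b ∞ volume)
    (has : ∀ t, s t * a t = a t)
    (h : MemLp (fun z : ℝ × ℝ => a z.1 * b z.2 * f z) 2 volume) :
    SchurWavelet.integralOp (fun z : ℝ × ℝ => a z.1 * b z.2 * f z) h =
      SchurWavelet.mulOp b hb ∘L SchurWavelet.integralOp f hf ∘L
        SchurWavelet.mulOp s hs ∘L SchurWavelet.mulOp a ha := by
  ext1 g
  apply Lp.ext
  simp only [ContinuousLinearMap.comp_apply]
  set g₁ := SchurWavelet.mulOp a ha g with hg₁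
  set g₂ := SchurWavelet.mulOp s hs g₁ with hg₂
  have hg : g₂ =ᵐ[volume] fun t => a t * g t := by
    filter_upwards [SchurWavelet.coeFn_mulOp hs g₁, SchurWavelet.coeFn_mulOp ha g] with t h1 h2
    rw [h1, h2, ← mul_assoc, has]
  filter_upwards [SchurWavelet.coeFn_integralOp h g, SchurWavelet.coeFn_integralOp hf g₂,
    SchurWavelet.coeFn_mulOp hb (SchurWavelet.integralOp f hf g₂)] with y h1 h2 h3
  rw [h1, h3, h2, ← integral_const_mul]
  refine integral_congr_ae ?_
  filter_upwards [hg] with x hx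
  rw [hx]
  ring

end IntegralOp

/-! ### Multipliers that are sums of tensors with bounded overlap -/

section TensorSum

open Filter Topology

/-- The two overlap factors combine as `(N β² · N)^{1/2} = N β`, and `(1 - p/2) / p = 1 / p^♭`. -/
theorem SchurWavelet.schattenNorm_le_of_tsum_le {H : Type*} [NormedAddCommGroup H]
    [InnerProductSpace ℂ H] {p : ℝ} (hp : 0 < p) (hp2 : p < 2) {N β : ℝ≥0} {E : ℝ≥0∞}
    {T : H →L[ℂ] H}
    (hT : ∑' n, SchurWavelet.singularValue n T ^ p ≤
      ((N * β ^ 2 : ℝ≥0) : ℝ≥0∞) ^ (p / 2) * (N : ℝ≥0∞) ^ (p / 2) * E ^ (1 - p / 2)) :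
    SchurWavelet.schattenNorm p T ≤ N * β * E ^ (1 / SchurWavelet.flat p) := by
  rw [SchurWavelet.schattenNorm]
  refine (ENNReal.rpow_le_rpow hT (by positivity)).trans (le_of_eq ?_)
  rw [← ENNReal.mul_rpow_of_nonneg ((N * β ^ 2 : ℝ≥0) : ℝ≥0∞) N (by positivity : 0 ≤ p / 2),
    ENNReal.mul_rpow_of_nonneg _ _ (by positivity), ← ENNReal.rpow_mul, ← ENNReal.rpow_mul]
  congr 1
  · have h1 : ((N * β ^ 2 : ℝ≥0) : ℝ≥0∞) * N = ((N : ℝ≥0∞) * β) ^ (2 : ℝ) := by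
      rw [ENNReal.rpow_two]; push_cast; ring
    rw [h1, ← ENNReal.rpow_mul, show (2 : ℝ) * (p / 2 * (1 / p)) = 1 by field_simp, ENNReal.rpow_one]
  · congr 1
    have : 2 - p ≠ 0 := by linarith
    rw [SchurWavelet.flat]
    field_simp

variable {a b : ℤ → ℝ → ℂ} {U : ℤ → Set ℝ} {N : ℕ} {β D : ℝ≥0}

open Classical in
theorem SchurWavelet.norm_sum_tensor_le (haU : ∀ l, ∀ t ∉ U l, a l t = 0)
    (hU : ∀ (L : Finset ℤ) (t : ℝ), (L.filter fun l => t ∈ U l).card ≤ N)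
    (z : ℝ × ℝ) (ha : ∀ l, ‖a l z.1‖ ≤ β) (hb : ∀ l, ‖b l z.2‖ ≤ D) (L : Finset ℤ) :
    ‖∑ l ∈ L, a l z.1 * b l z.2‖ ≤ N * (β * D) := by
  rw [← Finset.sum_filter_of_ne (p := fun l => z.1 ∈ U l) fun l _ h => by
    by_contra hl; exact h (by rw [haU l _ hl, zero_mul])]
  refine (norm_sum_le_of_le _ fun l _ => ?_).trans (b := ∑ l ∈ L.filter fun l => z.1 ∈ U l,
    ((β : ℝ) * D)) ?_
  · rw [norm_mul]
    exact mul_le_mul (ha l) (hb l) (norm_nonneg _) β.2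
  · rw [Finset.sum_const, nsmul_eq_mul]
    gcongr
    exact hU L z.1

open Classical in
theorem SchurWavelet.tendsto_sum_tensor (haU : ∀ l, ∀ t ∉ U l, a l t = 0)
    (hU : ∀ (L : Finset ℤ) (t : ℝ), (L.filter fun l => t ∈ U l).card ≤ N) (z : ℝ × ℝ) :
    Tendsto (fun m : ℕ => ∑ l ∈ Finset.Icc (-(m : ℤ)) m, a l z.1 * b l z.2) atTop
      (𝓝 (∑' l, a l z.1 * b l z.2)) := by
  have hfin : {l | z.1 ∈ U l}.Finite := by
    by_contra hinf
    obtain ⟨L, hL, hcard⟩ := Set.Infinite.exists_subset_card_eq hinf (N + 1)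
    have h1 := hU L z.1
    have h2 : ∀ l ∈ L, z.1 ∈ U l := fun l hl => hL hl
    rw [Finset.filter_true_of_mem h2] at h1
    omega
  have hsum : Summable fun l => a l z.1 * b l z.2 :=
    summable_of_hasFiniteSupport (hfin.subset fun l hl => by
      by_contra hl'
      exact hl (by simp only [haU l _ hl', zero_mul]))
  exact hsum.hasSum.comp (Finset.tendsto_Icc_neg (R := ℤ))

variable (ham : ∀ l, AEStronglyMeasurable (a l) volume) (hbm : ∀ l, AEStronglyMeasurable (b l) volume)
  (ha : ∀ᵐ t, ∀ l, ‖a l t‖ ≤ β) (hb : ∀ᵐ s, ∀ l, ‖b l s‖ ≤ D)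

include ha hb in
theorem SchurWavelet.ae_norm_tensor_le :
    ∀ᵐ z : ℝ × ℝ, (∀ l, ‖a l z.1‖ ≤ β) ∧ ∀ l, ‖b l z.2‖ ≤ D := by
  have h1 : ∀ᵐ z : ℝ × ℝ ∂(volume.prod volume), ∀ l, ‖a l z.1‖ ≤ β :=
    Measure.quasiMeasurePreserving_fst.ae ha
  have h2 : ∀ᵐ z : ℝ × ℝ ∂(volume.prod volume), ∀ l, ‖b l z.2‖ ≤ D :=
    Measure.quasiMeasurePreserving_snd.ae hb
  exact h1.and h2

include ham hbm in
theorem SchurWavelet.aestronglyMeasurable_tensor (l : ℤ) :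
    AEStronglyMeasurable (fun z : ℝ × ℝ => a l z.1 * b l z.2) volume :=
  (ham l).comp_fst.mul (hbm l).comp_snd

include ham hbm ha hb in
open Classical in
theorem SchurWavelet.memLp_tsum_tensor (haU : ∀ l, ∀ t ∉ U l, a l t = 0)
    (hU : ∀ (L : Finset ℤ) (t : ℝ), (L.filter fun l => t ∈ U l).card ≤ N) :
    MemLp (fun z : ℝ × ℝ => ∑' l, a l z.1 * b l z.2) ∞ volume := by
  refine memLp_top_of_bound (aestronglyMeasurable_of_tendsto_ae atTop
    (f := fun (m : ℕ) (z : ℝ × ℝ) => ∑ l ∈ Finset.Icc (-(m : ℤ)) m, a l z.1 * b l z.2)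
    (fun m => Finset.aestronglyMeasurable_fun_sum _ fun l _ =>
      SchurWavelet.aestronglyMeasurable_tensor ham hbm l)
    (ae_of_all _ fun z => SchurWavelet.tendsto_sum_tensor haU hU z)) (N * (β * D)) ?_
  filter_upwards [SchurWavelet.ae_norm_tensor_le ha hb] with z hz
  exact le_of_tendsto' (SchurWavelet.tendsto_sum_tensor haU hU z).norm fun m =>
    SchurWavelet.norm_sum_tensor_le haU hU z hz.1 hz.2 _

-- Dominated convergence in `L₂(ℝ²)`; since the operator norm is at most the `L₂` norm of the
-- kernel, the truncated operators converge in norm.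
include ham hbm ha hb in
open Classical in
theorem SchurWavelet.tendsto_eLpNorm_sum_tensor (haU : ∀ l, ∀ t ∉ U l, a l t = 0)
    (hU : ∀ (L : Finset ℤ) (t : ℝ), (L.filter fun l => t ∈ U l).card ≤ N)
    {f : ℝ × ℝ → ℂ} (hf : MemLp f 2 volume) :
    Tendsto (fun m : ℕ => eLpNorm (fun z : ℝ × ℝ => (∑' l, a l z.1 * b l z.2) * f z -
      ∑ l ∈ Finset.Icc (-(m : ℤ)) m, a l z.1 * b l z.2 * f z) 2 volume) atTop (𝓝 0) := by
  have hK := SchurWavelet.memLp_tsum_tensor ham hbm ha hb haU hU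
  have hmeas : ∀ m : ℕ, AEStronglyMeasurable (fun z : ℝ × ℝ => (∑' l, a l z.1 * b l z.2) * f z -
      ∑ l ∈ Finset.Icc (-(m : ℤ)) m, a l z.1 * b l z.2 * f z) volume := fun m =>
    (hK.1.mul hf.1).sub (Finset.aestronglyMeasurable_fun_sum _ fun l _ =>
      (SchurWavelet.aestronglyMeasurable_tensor ham hbm l).mul hf.1)
  have hlim : Tendsto (fun m : ℕ => ∫⁻ z : ℝ × ℝ, ‖(∑' l, a l z.1 * b l z.2) * f z -
      ∑ l ∈ Finset.Icc (-(m : ℤ)) m, a l z.1 * b l z.2 * f z‖ₑ ^ (2 : ℝ)) atTop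
      (𝓝 (∫⁻ _ : ℝ × ℝ, 0)) := by
    refine tendsto_lintegral_of_dominated_convergence'
      -- The partial sum and the full sum are each at most `N β D`.
      (fun z => ((2 * (N * (β * D)) : ℝ≥0) * ‖f z‖ₑ) ^ (2 : ℝ))
      (fun m => (hmeas m).enorm.pow_const _) (fun m => ?_) ?_ (ae_of_all _ fun z => ?_)
    · filter_upwards [SchurWavelet.ae_norm_tensor_le ha hb] with z hz
      have h1 := SchurWavelet.norm_sum_tensor_le haU hU z hz.1 hz.2 (Finset.Icc (-(m : ℤ)) m)
      have h2 := le_of_tendsto' (SchurWavelet.tendsto_sum_tensor (b := b) haU hU z).norm fun m =>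
        SchurWavelet.norm_sum_tensor_le haU hU z hz.1 hz.2 (Finset.Icc (-(m : ℤ)) m)
      refine ENNReal.rpow_le_rpow ?_ (by norm_num)
      rw [← Finset.sum_mul, ← sub_mul, enorm_mul]
      gcongr
      rw [enorm_eq_nnnorm, ENNReal.coe_le_coe, ← NNReal.coe_le_coe]
      push_cast
      refine (norm_sub_le _ _).trans ?_
      linarith
    · simp only [ENNReal.mul_rpow_of_nonneg _ _ (zero_le_two : (0 : ℝ) ≤ 2)]
      rw [lintegral_const_mul'' _ (hf.1.enorm.pow_const _)]
      refine ENNReal.mul_ne_top (by finiteness) ?_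
      have := lintegral_rpow_enorm_lt_top_of_eLpNorm_lt_top two_ne_zero ENNReal.ofNat_ne_top hf.2
      simpa using this.ne
    · have h1 : Tendsto (fun m : ℕ => (∑' l, a l z.1 * b l z.2) * f z -
          ∑ l ∈ Finset.Icc (-(m : ℤ)) m, a l z.1 * b l z.2 * f z) atTop (𝓝 0) := by
        have h2 := ((SchurWavelet.tendsto_sum_tensor (b := b) haU hU z).mul_const (f z)).const_sub
          ((∑' l, a l z.1 * b l z.2) * f z)
        simpa only [Finset.sum_mul, sub_self] using h2
      have h3 := (ENNReal.continuous_rpow_const (y := 2)).tendsto (0 : ℝ≥0∞) |>.comp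
        (by simpa using h1.enorm)
      simpa [Function.comp_def] using h3
  rw [lintegral_zero] at hlim
  have h4 := (ENNReal.continuous_rpow_const (y := 1 / 2)).tendsto (0 : ℝ≥0∞) |>.comp hlim
  rw [ENNReal.zero_rpow_of_pos (by norm_num)] at h4
  refine h4.congr fun m => ?_
  rw [eLpNorm_eq_lintegral_rpow_enorm_toReal two_ne_zero ENNReal.ofNat_ne_top]
  simp

include ham hbm ha hb in
open Classical in
/-- Schur multiplier bound for sums of elementary tensors whose first factors have bounded
overlap. -/
theorem SchurWavelet.multiplierNorm_tsum_tensor_le (haU : ∀ l, ∀ t ∉ U l, a l t = 0)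
    (hUm : ∀ l, MeasurableSet (U l))
    (hU : ∀ (L : Finset ℤ) (t : ℝ), (L.filter fun l => t ∈ U l).card ≤ N)
    (hK : MemLp (fun z : ℝ × ℝ => ∑' l, a l z.1 * b l z.2) ∞ volume)
    {p : ℝ} (hp : 0 < p) (hp2 : p < 2) :
    SchurWavelet.multiplierNorm p (fun z : ℝ × ℝ => ∑' l, a l z.1 * b l z.2) hK ≤
      N * β * SchurWavelet.ellNorm (SchurWavelet.flat p) fun l => eLpNorm (b l) ∞ volume := by
  refine iSup_le fun f => iSup_le fun hf => iSup_le fun hle => ?_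
  have hA : ∑' n, SchurWavelet.singularValue n (SchurWavelet.integralOp f hf) ^ p ≤ 1 := by
    rw [SchurWavelet.schattenNorm] at hle
    have := ENNReal.rpow_le_rpow hle hp.le
    rwa [← ENNReal.rpow_mul, one_div_mul_cancel hp.ne', ENNReal.rpow_one, ENNReal.one_rpow] at this
  have haL : ∀ l, MemLp (a l) ∞ volume := fun l =>
    memLp_top_of_bound (ham l) β (ha.mono fun t ht => ht l)
  have hbL : ∀ l, MemLp (b l) ∞ volume := fun l =>
    memLp_top_of_bound (hbm l) D (hb.mono fun t ht => ht l)
  let s : ℤ → ℝ → ℂ := fun l => (U l).indicator fun _ => 1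
  have hsL : ∀ l, MemLp (s l) ∞ volume := fun l =>
    memLp_top_of_bound ((measurable_const.indicator (hUm l)).aestronglyMeasurable) 1
      (ae_of_all _ fun t => by
        by_cases ht : t ∈ U l <;> simp [s, ht])
  have hab : ∀ l, MemLp (fun z : ℝ × ℝ => a l z.1 * b l z.2) ∞ volume := fun l =>
    memLp_top_of_bound (SchurWavelet.aestronglyMeasurable_tensor ham hbm l) (β * D) (by
      filter_upwards [SchurWavelet.ae_norm_tensor_le ha hb] with z hz
      rw [norm_mul]
      exact mul_le_mul (hz.1 l) (hz.2 l) (norm_nonneg _) β.2)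
  have habf : ∀ l, MemLp (fun z : ℝ × ℝ => a l z.1 * b l z.2 * f z) 2 volume := fun l =>
    hf.mul' (hab l)
  have hsum : ∀ m : ℕ, MemLp (fun z : ℝ × ℝ =>
      ∑ l ∈ Finset.Icc (-(m : ℤ)) m, a l z.1 * b l z.2 * f z) 2 volume := fun m =>
    memLp_finsetSum _ fun l _ => habf l
  refine SchurWavelet.schattenNorm_le_of_tsum_le hp hp2
    (E := ∑' l, eLpNorm (b l) ∞ volume ^ SchurWavelet.flat p)
    (SchurWavelet.tsum_singularValue_rpow_le_of_tendsto
      (u := fun m : ℕ => SchurWavelet.integralOp _ (hsum m)) ?_ fun m => ?_)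
  · exact tendsto_of_tendsto_of_tendsto_of_le_of_le tendsto_const_nhds
      (SchurWavelet.tendsto_eLpNorm_sum_tensor ham hbm ha hb haU hU hf) (fun _ => zero_le)
      fun m => SchurWavelet.enorm_integralOp_sub_le _ _
  · set L := Finset.Icc (-(m : ℤ)) m
    have hop : SchurWavelet.integralOp _ (hsum m) = ∑ l ∈ L, SchurWavelet.mulOp (b l) (hbL l) ∘L
        SchurWavelet.integralOp f hf ∘L SchurWavelet.mulOp (s l) (hsL l) ∘L
          SchurWavelet.mulOp (a l) (haL l) := by
      rw [SchurWavelet.integralOp_sum L habf]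
      refine Finset.sum_congr rfl fun l _ => ?_
      refine SchurWavelet.integralOp_tensor_mul hf (haL l) (hsL l) (hbL l) (fun t => ?_) _
      by_cases ht : t ∈ U l
      · simp [s, ht]
      · simp [s, ht, haU l t ht]
    rw [hop]
    -- `B` bounds `∑ |a_l|²` and `N` bounds the sum of the squared indicators, both pointwise. The
    -- crude bound `D` plays no part in the estimate.
    refine (SchurWavelet.tsum_singularValue_sum_le (κ := fun l => eLpNorm (b l) ∞ volume)
      (B := N * β ^ 2) (N := N) (fun l _ x => SchurWavelet.enorm_mulOp_le (hbL l) x) (fun x => ?_)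
      (fun x => ?_) hp hp2 (hA.trans_lt ENNReal.one_lt_top).ne).trans ?_
    · have hadj : ∀ l, adjoint (SchurWavelet.mulOp (s l) (hsL l)) =
          SchurWavelet.mulOp (s l) (hsL l) := fun l => SchurWavelet.adjoint_mulOp _ fun t => by
        by_cases ht : t ∈ U l <;> simp [s, ht]
      simp only [hadj]
      refine SchurWavelet.sum_enorm_mulOp_sq_le L hsL (ae_of_all _ fun t => ?_) x
      have h1 : ∀ l, ‖s l t‖ₑ ^ 2 = if t ∈ U l then 1 else 0 := fun l => by
        by_cases ht : t ∈ U l <;> simp [s, ht]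
      simp only [h1, Finset.sum_boole]
      exact_mod_cast hU L t
    · have h1 := SchurWavelet.sum_enorm_mulOp_sq_le L haL (c := ((N * β ^ 2 : ℝ≥0) : ℝ≥0∞))
        (by
          filter_upwards [ha] with t ht
          have h2 : ∀ l, ‖a l t‖ₑ ^ 2 ≤ if t ∈ U l then (β : ℝ≥0∞) ^ 2 else 0 := fun l => by
            by_cases htl : t ∈ U l
            · simp only [htl, if_true]
              gcongr
              rw [enorm_eq_nnnorm, ENNReal.coe_le_coe]
              exact ht l
            · simp [htl, haU l t htl]
          refine (Finset.sum_le_sum fun l _ => h2 l).trans ?_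
          rw [← Finset.sum_filter, Finset.sum_const, nsmul_eq_mul]
          push_cast
          gcongr
          exact_mod_cast hU L t) x
      simp only [enorm_eq_nnnorm] at h1
      norm_cast at h1
      rw [← NNReal.coe_le_coe] at h1
      push_cast at h1 ⊢
      exact h1
    · refine (mul_le_mul_right hA _).trans ?_
      rw [mul_one]
      refine mul_le_mul_right (ENNReal.rpow_le_rpow (ENNReal.sum_le_tsum L) (by linarith)) _

end TensorSum

/-! ### Overlap, size and measurability for the wavelet system -/

section Wavelet

theorem SchurWavelet.quasiMeasurePreserving_affine {c : ℝ} (hc : c ≠ 0) (d : ℝ) :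
    Measure.QuasiMeasurePreserving (fun t : ℝ => c * t - d) volume volume := by
  have h1 : Measure.QuasiMeasurePreserving (fun t : ℝ => c * t) volume volume :=
    ⟨measurable_const_mul c, by
      rw [Real.map_volume_mul_left hc]
      exact Measure.smul_absolutelyContinuous⟩
  exact (measurePreserving_sub_right volume d).quasiMeasurePreserving.comp h1

theorem SchurWavelet.ae_norm_le_toNNReal {α : Type*} [MeasurableSpace α] {μ : Measure α}
    {f : α → ℂ} (hf : MemLp f ∞ μ) : ∀ᵐ x ∂μ, ‖f x‖ ≤ (eLpNorm f ∞ μ).toNNReal := by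
  have h := ae_le_eLpNormEssSup (f := f) (μ := μ)
  rw [← eLpNorm_exponent_top, ← ENNReal.coe_toNNReal hf.2.ne] at h
  filter_upwards [h] with x hx
  rw [enorm_eq_nnnorm, ENNReal.coe_le_coe] at hx
  exact hx

theorem SchurWavelet.ae_norm_waveletFun_le {φ : ℝ → ℂ} (hφ : MemLp φ ∞ volume) (j : ℤ) :
    ∀ᵐ t, ∀ l, ‖SchurWavelet.waveletFun φ j l t‖ ≤
      ((2 : ℝ≥0) ^ ((j : ℝ) / 2) * (eLpNorm φ ∞ volume).toNNReal : ℝ≥0) := by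
  rw [ae_all_iff]
  intro l
  filter_upwards [(SchurWavelet.quasiMeasurePreserving_affine (c := (2 : ℝ) ^ j) (by positivity)
    l).ae (SchurWavelet.ae_norm_le_toNNReal hφ)] with t ht
  rw [SchurWavelet.waveletFun, norm_mul, Complex.norm_real, Real.norm_of_nonneg (by positivity)]
  rw [NNReal.coe_mul, NNReal.coe_rpow]
  exact mul_le_mul_of_nonneg_left ht (by positivity)

theorem SchurWavelet.aestronglyMeasurable_waveletFun {φ : ℝ → ℂ} (hφ : MemLp φ ∞ volume)
    (j l : ℤ) : AEStronglyMeasurable (SchurWavelet.waveletFun φ j l) volume :=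
  (hφ.1.comp_quasiMeasurePreserving (SchurWavelet.quasiMeasurePreserving_affine
    (c := (2 : ℝ) ^ j) (by positivity) l)).const_mul _

/-- An interval containing the support of `φ_{j,l}` when `φ` vanishes off `[-R, R]`. -/
def SchurWavelet.supportInterval (R : ℕ) (j l : ℤ) : Set ℝ :=
  Set.Icc ((l - R) / (2 : ℝ) ^ j) ((l + R) / (2 : ℝ) ^ j)

theorem SchurWavelet.mem_supportInterval {R : ℕ} {j l : ℤ} {t : ℝ} :
    t ∈ SchurWavelet.supportInterval R j l ↔ |(2 : ℝ) ^ j * t - l| ≤ R := by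
  have h : (0 : ℝ) < (2 : ℝ) ^ j := by positivity
  rw [SchurWavelet.supportInterval, Set.mem_Icc, div_le_iff₀ h, le_div_iff₀ h, abs_le]
  constructor <;> rintro ⟨h1, h2⟩ <;> constructor <;> linarith

theorem SchurWavelet.waveletFun_eq_zero {φ : ℝ → ℂ} {R : ℕ} (hR : ∀ x, (R : ℝ) < |x| → φ x = 0)
    (j l : ℤ) {t : ℝ} (ht : t ∉ SchurWavelet.supportInterval R j l) :
    SchurWavelet.waveletFun φ j l t = 0 := by
  rw [SchurWavelet.mem_supportInterval, not_le] at ht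
  rw [SchurWavelet.waveletFun, hR _ ht, mul_zero]

open Classical in
theorem SchurWavelet.card_supportInterval_le (R : ℕ) (j : ℤ) (L : Finset ℤ) (t : ℝ) :
    (L.filter fun l => t ∈ SchurWavelet.supportInterval R j l).card ≤ 2 * R + 1 := by
  -- These are the integers within distance `R` of `2^j t`.
  have hsub : (L.filter fun l => t ∈ SchurWavelet.supportInterval R j l) ⊆
      Finset.Icc (⌈(2 : ℝ) ^ j * t⌉ - R) (⌊(2 : ℝ) ^ j * t⌋ + R) := by
    intro l hl
    have h1 := SchurWavelet.mem_supportInterval.1 (Finset.mem_filter.1 hl).2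
    rw [abs_le] at h1
    rw [Finset.mem_Icc, sub_le_iff_le_add, ← sub_le_iff_le_add (a := l), Int.ceil_le, Int.le_floor]
    push_cast
    constructor <;> linarith
  refine (Finset.card_le_card hsub).trans ?_
  rw [Int.card_Icc]
  have := Int.floor_le_ceil ((2 : ℝ) ^ j * t)
  omega

theorem SchurWavelet.exists_ae_norm_waveletCoeff_le {φ : ℝ → ℂ} (hφ : MemLp φ ∞ volume) {R : ℕ}
    (hR : ∀ x, (R : ℝ) < |x| → φ x = 0) {k : ℝ × ℝ → ℂ} (hk : MemLp k ∞ volume) (j : ℤ) :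
    ∃ D : ℝ≥0, ∀ᵐ s, ∀ l, ‖SchurWavelet.waveletCoeff φ k j l s‖ ≤ D := by
  set β : ℝ≥0 := (2 : ℝ≥0) ^ ((j : ℝ) / 2) * (eLpNorm φ ∞ volume).toNNReal
  -- The last factor is the length of the support interval; the bound is uniform in `l`.
  refine ⟨β * (eLpNorm k ∞ volume).toNNReal * (2 * R / 2 ^ j), ?_⟩
  have hswap : ∀ᵐ z : ℝ × ℝ ∂(volume.prod volume), ‖k z.swap‖ ≤ (eLpNorm k ∞ volume).toNNReal :=
    (Measure.measurePreserving_swap (μ := volume) (ν := volume)).quasiMeasurePreserving.ae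
      (SchurWavelet.ae_norm_le_toNNReal hk)
  filter_upwards [Measure.ae_ae_of_ae_prod hswap] with s hs l
  have h1 : SchurWavelet.waveletCoeff φ k j l s = ∫ t in SchurWavelet.supportInterval R j l,
      SchurWavelet.waveletFun φ j l t * k (t, s) := by
    refine (setIntegral_eq_integral_of_forall_compl_eq_zero fun t ht => ?_).symm
    rw [SchurWavelet.waveletFun_eq_zero hR j l ht, zero_mul]
  rw [h1]
  have hpos : (0 : ℝ) ≤ (2 * R / 2 ^ j : ℝ) := by positivity
  have hlen : ((l + R) / (2 : ℝ) ^ j) - ((l - R) / (2 : ℝ) ^ j) = 2 * R / 2 ^ j := by ring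
  refine (norm_setIntegral_le_of_norm_le_const_ae (C := β * (eLpNorm k ∞ volume).toNNReal)
    (by simp [SchurWavelet.supportInterval]) ?_).trans (le_of_eq ?_)
  · refine ae_restrict_of_ae ?_
    filter_upwards [hs, SchurWavelet.ae_norm_waveletFun_le hφ j] with t h2 h3
    rw [norm_mul]
    exact mul_le_mul (h3 l) h2 (norm_nonneg _) β.2
  · rw [SchurWavelet.supportInterval, Measure.real, Real.volume_Icc, hlen,
      ENNReal.toReal_ofReal hpos]
    push_cast
    rfl

theorem SchurWavelet.aestronglyMeasurable_waveletCoeff {φ : ℝ → ℂ} (hφ : MemLp φ ∞ volume)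
    {k : ℝ × ℝ → ℂ} (hk : MemLp k ∞ volume) (j l : ℤ) :
    AEStronglyMeasurable (SchurWavelet.waveletCoeff φ k j l) volume := by
  have hs : AEStronglyMeasurable (fun z : ℝ × ℝ => k z.swap) (volume.prod volume) :=
    hk.1.comp_quasiMeasurePreserving
      (Measure.measurePreserving_swap (μ := volume) (ν := volume)).quasiMeasurePreserving
  have h : AEStronglyMeasurable (fun z : ℝ × ℝ => SchurWavelet.waveletFun φ j l z.2 * k z.swap)
      (volume.prod volume) :=
    (SchurWavelet.aestronglyMeasurable_waveletFun hφ j l).comp_snd.mul hs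
  exact h.integral_prod_right'

end Wavelet

/-! ### The wavelet multiplier estimate -/

theorem mainTheorem6 (φ : ℝ → ℂ) (hφ : MemLp φ ∞ volume) (hφc : HasCompactSupport φ)
    (hφw : SchurWavelet.IsOrthonormalWavelet φ) :
    ∃ C : ℝ≥0, ∀ (p : ℝ), 0 < p → p < 2 →
      ∀ (k : ℝ × ℝ → ℂ), MemLp k ∞ volume → ∀ (j : ℤ),
        ∃ hkj : MemLp (SchurWavelet.scalePart φ k j) ∞ volume,
          SchurWavelet.multiplierNorm p (SchurWavelet.scalePart φ k j) hkj ≤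
            (C : ℝ≥0∞) * (2 : ℝ≥0∞) ^ ((j : ℝ) / 2) *
              SchurWavelet.ellNorm (SchurWavelet.flat p)
                (fun l : ℤ => eLpNorm (SchurWavelet.waveletCoeff φ k j l) ∞ volume) := by
  classical
  obtain ⟨r, hr⟩ := hφc.isCompact.isBounded.exists_norm_le
  obtain ⟨R, hrR⟩ := exists_nat_ge r
  have hR : ∀ x, (R : ℝ) < |x| → φ x = 0 := fun x hx =>
    image_eq_zero_of_notMem_tsupport fun hmem => absurd (hr x hmem) (by
      rw [Real.norm_eq_abs]; linarith)
  -- Overlap number times `‖φ‖_∞`; the factor `2^{j/2}` comes from the normalization of `φ_{j,l}`.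
  refine ⟨(2 * R + 1 : ℕ) * (eLpNorm φ ∞ volume).toNNReal, fun p hp hp2 k hk j => ?_⟩
  obtain ⟨D, hD⟩ := SchurWavelet.exists_ae_norm_waveletCoeff_le hφ hR hk j
  have ham := SchurWavelet.aestronglyMeasurable_waveletFun hφ j
  have hbm := SchurWavelet.aestronglyMeasurable_waveletCoeff hφ hk j
  have ha := SchurWavelet.ae_norm_waveletFun_le hφ j
  have haU : ∀ l, ∀ t ∉ SchurWavelet.supportInterval R j l, SchurWavelet.waveletFun φ j l t = 0 :=
    fun l t ht => SchurWavelet.waveletFun_eq_zero hR j l ht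
  have hU := SchurWavelet.card_supportInterval_le R j
  have hK := SchurWavelet.memLp_tsum_tensor ham hbm ha hD haU hU
  refine ⟨hK, (SchurWavelet.multiplierNorm_tsum_tensor_le ham hbm ha hD haU
    (fun l => measurableSet_Icc) hU hK hp hp2).trans (le_of_eq ?_)⟩
  congr 1
  rw [ENNReal.coe_mul, ENNReal.coe_mul, ENNReal.coe_rpow_of_ne_zero two_ne_zero]
  push_cast
  ring
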